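/- **Economy.** Time is continuous. There are three types of infinitely lived agents $i=1,2,3$ (indices modulo 3) with population shares $\theta_i>0$, $\sum_i\theta_i=1$, three commodities $1,2,3$ and fiat money $m$. Type $i$ consumes only good $i$ (utility $U_i$) and then immediately produces good $i+1$ (disutility $D_i$), where $U_i>D_i>0$ and $u_i=U_i-D_i$. The storage cost of good $k$ is $c_k\in\mathbb R$; money has no storage cost. The discount rate is $\rho>0$, the matching intensity is $\alpha>0$, money is confiscated at rate $\delta_m\ge 0$, a fraction $M\in[0,1)$ of the population holds money, and the government buys commodities at rate $\delta_g=\delta_mM/(1-M)$. **Distributions and strategies.** $p_{i,j}$ is the share of agents that are of type $i$ and hold object $j$. Let $\Omega$ be the set of $p=(p_{i,j})$ with $p_{i,j}\ge0$, $p_{i,i}=0$, $\sum_jp_{i,j}=\theta_i$ and $\sum_ip_{i,m}=M$, and let $\|p\|=\sqrt{\sum_{i,j}p_{i,j}^2}$. The decision of type $i$ to give up $j$ for $k$ is $s^i_{j,k}$, where $s^i_{j,i}=1$ for $j\ne i$, $s^i_{j,j}=0$, and $s^i_{k,j}=1-s^i_{j,k}$ for distinct $j,k\in\{i+1,i+2,m\}$;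 so it is given by the triple $\mathbf s^i=(s^i_{i+1,m},s^i_{i+2,m},s^i_{i+1,i+2})$, which must lie in $$\Sigma=\{(1,1,1),(1,0,1),(1,1,0),(0,1,0),(0,0,1),(0,0,0)\}.$$ Time-dependent strategies are piecewise continuous maps of $t\ge0$ into $\Sigma$. **Inventory dynamics.** For $j\ne i$, with $k$ ranging over all four objects and $i'$ over all types, $$\dot p_{i,j}=\alpha\Big\{\sum_{i',k}p_{i,k}p_{i',j}s^i_{k,j}s^{i'}_{j,k}-\sum_{i',k}p_{i,j}p_{i',k}s^i_{j,k}s^{i'}_{k,j}+\mathbf 1_{j=i+1}\sum_{i',k}p_{i,k}p_{i',i}s^{i'}_{i,k}\Big\}+g_{i,j},$$ where $g_{i,i+1}=\delta_mp_{i,m}-\delta_gp_{i,i+1}$, $g_{i,i+2}=-\delta_gp_{i,i+2}$ and $g_{i,m}=\delta_g(p_{i,i+1}+p_{i,i+2})-\delta_mp_{i,m}$; and $p_{i,i}\equiv0$. Trajectories live in $\Omega$. **Values.** Given a path $p(t)$ and population strategies $\mathbf s(t)$, consider one individual of type $i$ who plays $\sigma(t)\in\Sigma$. Her holding is a Markov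 process on $\{i+1,i+2,m\}$ that jumps from $j$ to $k\neq j$ at rate $$\alpha\,\sigma_{j,k}\sum_{i'}p_{i',k}s^{i'}_{k,j}+\mathbf 1_{k=i+1}\,\alpha\sum_{i'}p_{i',i}s^{i'}_{i,j}+\mathbf 1_{j=m,\,k=i+1}\,\delta_m+\mathbf 1_{j\ne m,\,k=m}\,\delta_g .$$ Let $\pi_{l,j}(\tau,t)$ be its transition probabilities (from $j$ at time $t$ to $l$ at time $\tau$). Her value is $$V_{i,j}(t)=\int_t^\infty e^{-\rho(\tau-t)}\sum_l\pi_{l,j}(\tau,t)\Big(\alpha\sum_{i'}p_{i',i}(\tau)s^{i'}_{i,l}(\tau)\,u_i-c_l\Big)d\tau,\qquad c_m:=\delta_mD_i .$$ **Best response and equilibrium.** $\sigma$ is the best response if it attains $\sup_{\tilde\sigma}V_{i,j}(t)$ over all admissible $\tilde\sigma$, for all $t\ge0$ and all $j\in\{i+1,i+2,m\}$, and if, except at isolated times (finitely many in every bounded interval), for all distinct $j,k\in\{i+1,i+2,m\}$, with $V$ denoting the value under $\sigma$: an indifferent individual ($V_{i,j}=V_{i,k}$) would choose $\sigma_{j,k}=1/2$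 (so, as $\sigma$ takes values in $\Sigma$, no indifference occurs); and if no agent is willing to trade with her between $j$ and $k$ in either direction, that is $\sum_{i'}p_{i',k}s^{i'}_{k,j}=\sum_{i'}p_{i',j}s^{i'}_{j,k}=0$, then still $\sigma_{j,k}=1$ if $V_{i,j}<V_{i,k}$ and $\sigma_{j,k}=0$ if $V_{i,j}>V_{i,k}$. A pattern $(p(t),\mathbf s(t))$, with $p$ a trajectory of the inventory dynamics under $\mathbf s$, is a *dynamic Nash equilibrium* if, for every type $i$, $\mathbf s^i$ is the best response to $\mathbf s$. A pair $(p^*,\mathbf s^*)\in\Omega\times\Sigma^3$ is a *Nash steady state* if the constant pattern is a dynamic Nash equilibrium. **Proposition 4.** Let $(p^*,\mathbf s^*)$ be a Nash steady state whose distribution $p^*$ is asymptotically stable (Lyapunov stable and locally attracting, relative to $\Omega$) for the inventory dynamics under the constant strategies $\mathbf s^*$. Then there is $\epsilon>0$ such that, for every initial distribution $p_0\in\Omega$ with $\|p_0-p^*\|\le\epsilon$, the inventory dynamics under $\mathbf s^*$ has a trajectory $p(t)$, $t\ge 0$, with $p(0)=p_0$, and for every such trajectory the pattern $(p(t),\mathbf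 s^*)$, in which everyone keeps playing the constant steady-state strategies, is a dynamic Nash equilibrium. -/

import Mathlib

open Set Filter Topology MeasureTheory

noncomputable section

namespace Search

/-- The four storable objects: `some k` is commodity `k`, and `none` is fiat money. Types of agents
and commodities are both labelled by `Fin 3`, whose addition is modulo 3. -/
abbrev Obj : Type := Option (Fin 3)

/-- Parameters of the economy, with their standing sign restrictions. -/
structure Economy where
  /-- matching intensity -/
  α : ℝ
  /-- discount rate -/
  ρ : ℝ
  /-- Poisson rate at which money is confiscated from a money holder -/
  δm : ℝ
  /-- fraction of the population holding money -/
  M : ℝ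
  /-- population shares of the three types -/
  θ : Fin 3 → ℝ
  /-- utility from consumption -/
  U : Fin 3 → ℝ
  /-- disutility of production -/
  D : Fin 3 → ℝ
  /-- storage costs of the three commodities (of any sign) -/
  c : Fin 3 → ℝ
  α_pos : 0 < α
  ρ_pos : 0 < ρ
  δm_nonneg : 0 ≤ δm
  M_nonneg : 0 ≤ M
  M_lt_one : M < 1
  θ_pos : ∀ i, 0 < θ i
  θ_sum : ∑ i, θ i = 1
  D_pos : ∀ i, 0 < D i
  D_lt_U : ∀ i, D i < U i

/-- Net utility of consuming and immediately producing. -/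
def Economy.u (E : Economy) (i : Fin 3) : ℝ := E.U i - E.D i

/-- Rate at which the government buys a commodity from its holder (balanced budget). -/
def Economy.δg (E : Economy) : ℝ := E.δm * E.M / (1 - E.M)

/-- A distribution of holdings: `p i j` is the share of the population that is of type `i` and
holds object `j`. -/
abbrev Dist : Type := Fin 3 → Obj → ℝ

/-- The set `Ω` of feasible distributions. -/
def Economy.feasible (E : Economy) : Set Dist :=
  {p | (∀ i j, 0 ≤ p i j) ∧ (∀ i, p i (some i) = 0) ∧ (∀ i, ∑ j, p i j = E.θ i) ∧
    ∑ i, p i none = E.M}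

/-- Euclidean distance between two distributions. -/
def euclDist (p q : Dist) : ℝ := √(∑ i, ∑ j, (p i j - q i j) ^ 2)

/-- A trading choice of an agent of type `i`, coded as the triple
`(s_{i+1,m}, s_{i+2,m}, s_{i+1,i+2})`. -/
abbrev Choice : Type := ℝ × ℝ × ℝ

/-- The six transitive pure choices. -/
def pureChoices : Set Choice :=
  {(1, 1, 1), (1, 0, 1), (1, 1, 0), (0, 1, 0), (0, 0, 1), (0, 0, 0)}

/-- `accept i x j k` is `s^i_{j,k}`, the decision of an agent of type `i` to give up `j` for `k`
under the choice `x`. Good `i` is never held and always accepted, an object is never traded for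
itself, and `s_{k,j} = 1 - s_{j,k}` for the other pairs. -/
def accept (i : Fin 3) (x : Choice) (j k : Obj) : ℝ :=
  if j = some i then 0
  else if k = some i then 1
  else if j = k then 0
  else if j = some (i + 1) ∧ k = none then x.1
  else if j = none ∧ k = some (i + 1) then 1 - x.1
  else if j = some (i + 2) ∧ k = none then x.2.1
  else if j = none ∧ k = some (i + 2) then 1 - x.2.1
  else if j = some (i + 1) ∧ k = some (i + 2) then x.2.2
  else 1 - x.2.2

/-- A symmetric strategy profile at one instant: one choice for each type. -/
abbrev Profile : Type := Fin 3 → Choice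

/-- Mass of agents who hold `k` and are willing to give it up for `j`. -/
def partners (p : Dist) (s : Profile) (j k : Obj) : ℝ :=
  ∑ i', p i' k * accept i' (s i') k j

/-- Right-hand side of the inventory dynamics. The first two terms are exchanges through which
agents of type `i` acquire, respectively give up, object `j`; the third one counts agents of type
`i` who obtain their consumption good and then produce good `i + 1`; the last one is the
government. -/
def Economy.field (E : Economy) (s : Profile) (p : Dist) : Dist := fun i j =>
  if j = some i then 0
  else
    E.α * (∑ k, p i k * accept i (s i) k j * (∑ i', p i' j * accept i' (s i') j k)
      - ∑ k, p i j * accept i (s i) j k * (∑ i', p i' k * accept i' (s i') k j)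
      + if j = some (i + 1) then
          ∑ k, p i k * (∑ i', p i' (some i) * accept i' (s i') (some i) k)
        else 0)
    + (if j = none then E.δg * (p i (some (i + 1)) + p i (some (i + 2))) - E.δm * p i none
       else if j = some (i + 1) then E.δm * p i none - E.δg * p i j
       else - E.δg * p i j)

/-- A function of time `t ≥ 0` is piecewise continuous if in every bounded time interval it has at
most finitely many discontinuities. (All functions below to which this is applied take finitely
many values, so one-sided limits exist automatically.) -/
def PiecewiseCont {X : Type*} [TopologicalSpace X] (f : ℝ → X) : Prop :=
  ∀ T : ℝ, {t | t ∈ Icc 0 T ∧ ¬ ContinuousWithinAt f (Ici 0) t}.Finite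

/-- A time path of pure choices. -/
def AdmissibleChoice (x : ℝ → Choice) : Prop :=
  (∀ t, 0 ≤ t → x t ∈ pureChoices) ∧ PiecewiseCont x

/-- A time path of strategies for the whole population. -/
def AdmissibleProfile (s : ℝ → Profile) : Prop :=
  (∀ t, 0 ≤ t → ∀ i, s t i ∈ pureChoices) ∧ PiecewiseCont s

/-- `p` is a trajectory, for `t ≥ 0`, of the inventory dynamics in the set of feasible
distributions under the strategies `s`; the differential equation holds wherever `s` does not
jump. -/
def Economy.IsTrajectory (E : Economy) (s : ℝ → Profile) (p : ℝ → Dist) : Prop :=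
  ContinuousOn p (Ici 0) ∧ (∀ t, 0 ≤ t → p t ∈ E.feasible) ∧
    ∀ t, 0 < t → ContinuousAt s t → HasDerivAt p (E.field (s t) (p t)) t

/-- Transition rate from holding `j` to holding `k ≠ j`, for an individual of type `i` who plays the
choice `x` while the population plays `s` and is distributed according to `p`. -/
def Economy.rate (E : Economy) (i : Fin 3) (x : Choice) (s : Profile) (p : Dist) (j k : Obj) : ℝ :=
  if j = some i ∨ k = some i then 0
  else
    E.α * accept i x j k * partners p s j k
    + (if k = some (i + 1) then E.α * partners p s j (some i) else 0)
    + (if j = none ∧ k = some (i + 1) then E.δm else 0)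
    + (if j ≠ none ∧ k = none then E.δg else 0)

/-- Generator of the holdings of that individual: `rate` off the diagonal and zero row sums. -/
def Economy.gen (E : Economy) (i : Fin 3) (x : Choice) (s : Profile) (p : Dist) (j k : Obj) : ℝ :=
  if j = k then - ∑ l ∈ Finset.univ.erase j, E.rate i x s p j l else E.rate i x s p j k

/-- `π τ l` is the probability that a Markov process with generator `A`, being at `j` at time `t`,
is at `l` at time `τ ≥ t`: the forward equation holds wherever `A` does not jump. -/
def IsTransition (A : ℝ → Obj → Obj → ℝ) (t : ℝ) (j : Obj) (π : ℝ → Obj → ℝ) : Prop :=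
  ContinuousOn π (Ici t) ∧ (∀ l, π t l = if l = j then 1 else 0) ∧
    ∀ τ, t < τ → ContinuousAt A τ → HasDerivAt π (fun k => ∑ l, A τ l k * π τ l) τ

/-- Expected utility flow, net of storage cost, of an individual of type `i` holding `l`; a money
holder's flow cost is the expected disutility of producing after a confiscation. -/
def Economy.flow (E : Economy) (i : Fin 3) (s : Profile) (p : Dist) (l : Obj) : ℝ :=
  E.α * partners p s l (some i) * E.u i - l.elim (E.δm * E.D i) E.c

/-- `w` is the expected discounted utility from time `t` on of an individual of type `i` who holds
`j` at time `t` and plays `x`, when the population plays `s` along the path `p`. -/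
def Economy.IsValue (E : Economy) (p : ℝ → Dist) (s : ℝ → Profile) (i : Fin 3) (x : ℝ → Choice)
    (t : ℝ) (j : Obj) (w : ℝ) : Prop :=
  ∃ π : ℝ → Obj → ℝ,
    IsTransition (fun τ => E.gen i (x τ) (s τ) (p τ)) t j π ∧
    IntegrableOn
      (fun τ => Real.exp (-E.ρ * (τ - t)) * ∑ l, π τ l * E.flow i (s τ) (p τ) l) (Ioi t) ∧
    w = ∫ τ in Ioi t, Real.exp (-E.ρ * (τ - t)) * ∑ l, π τ l * E.flow i (s τ) (p τ) l

/-- `x` is the best response of an individual of type `i` to the strategies `s` along `p`. It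
attains, at every time and for every holding, the supremum of the value over all admissible time
paths of choices. In addition, except at isolated times, it obeys two conventions that make the
best response unique: (a) an indifferent individual chooses `1/2`; (b) between two objects for
which she meets no willing partner in either direction, so that her decision has no effect on her
payoff, she still ranks the objects by their values. -/
def Economy.IsBestResponse (E : Economy) (p : ℝ → Dist) (s : ℝ → Profile) (i : Fin 3)
    (x : ℝ → Choice) : Prop :=
  AdmissibleChoice x ∧
  ∃ V : ℝ → Obj → ℝ,
    (∀ t, 0 ≤ t → ∀ j, j ≠ some i →
      E.IsValue p s i x t j (V t j) ∧
      IsLUB {w | ∃ y, AdmissibleChoice y ∧ E.IsValue p s i y t j w} (V t j)) ∧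
    ∃ S : Set ℝ, (∀ T : ℝ, (S ∩ Icc 0 T).Finite) ∧
      ∀ t, 0 ≤ t → t ∉ S → ∀ j k, j ≠ some i → k ≠ some i → j ≠ k →
        (V t j = V t k → accept i (x t) j k = 1 / 2) ∧
        (partners (p t) (s t) j k = 0 → partners (p t) (s t) k j = 0 →
          (V t j < V t k → accept i (x t) j k = 1) ∧
          (V t k < V t j → accept i (x t) j k = 0))

/-- The pattern `(p, s)` is a (dynamic) Nash equilibrium. -/
def Economy.IsNash (E : Economy) (p : ℝ → Dist) (s : ℝ → Profile) : Prop :=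
  AdmissibleProfile s ∧ E.IsTrajectory s p ∧
    ∀ i, E.IsBestResponse p s i (fun t => s t i)

/-- `(p, s)` is a Nash steady state: the constant pattern is a Nash equilibrium. -/
def Economy.IsNashSteadyState (E : Economy) (p : Dist) (s : Profile) : Prop :=
  E.IsNash (fun _ => p) (fun _ => s)

/-- The distribution `q` is asymptotically stable for the inventory dynamics in the feasible set
under the constant strategies `s`: it is a Lyapunov stable rest point and it attracts all nearby
trajectories. -/
def Economy.IsAsymptoticallyStable (E : Economy) (s : Profile) (q : Dist) : Prop :=
  q ∈ E.feasible ∧ E.field s q = 0 ∧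
  (∀ ε > 0, ∃ δ > 0, ∀ p, E.IsTrajectory (fun _ => s) p → euclDist (p 0) q < δ →
    ∀ t, 0 ≤ t → euclDist (p t) q < ε) ∧
  ∃ δ > 0, ∀ p, E.IsTrajectory (fun _ => s) p → euclDist (p 0) q < δ →
    Tendsto (fun t => euclDist (p t) q) atTop (𝓝 0)

end Search

end

/-!
At a Nash steady state the value `U j` of holding `j` is constant
in time, so convention (a) of the best response forbids ties: the values of the three storable
objects are pairwise distinct. Moreover the steady-state choice gives up an object exactly for
those of higher value (`exists_steady_value_ranks`). Indeed let `y` be the pure choice that ranks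
the objects by `U`; then `U` falls short of the value of playing `y` by the discounted gains
`(A_y - A_x) U ≥ 0`, which optimality forces to vanish. So the steady-state choice `x` can differ
from `y` only on pairs of objects without willing partners in either direction, where
convention (b) applies.

By Lyapunov stability a trajectory `p(t)` that starts close to the rest point stays close to it.
Then the value of keeping `x` along `p(t)` stays close to `U`
uniformly in time, because `U` almost solves the Bellman equation along the path
(`IsValue.abs_sub_le`). Hence it ranks the objects as `U` does, `x` is the ranking choice at every
time, and a verification argument gives its optimality (`IsValue.le_of_ranks`). Both comparisons
are instances of one supersolution estimate for discounted rewards of a time-inhomogeneous Markov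
chain, `IsTransition.integral_le`. The value is differentiable in the initial time because it is
the product of a solution of the backward equation with an integral that does not involve
the initial state (`exists_transition_and_value`).

Trajectories exist for all times because the vector field, precomposed with truncation of every
coordinate to `[0, 1]`, is bounded and Lipschitz, and its solutions from feasible points stay
feasible, so that the truncation is never active (`exists_isTrajectory`).
-/

open scoped NNReal

namespace Search

/-! ### Global solutions of ordinary differential equations -/

/-- A continuous function whose derivative is nonpositive off a finite set does not increase. The
exceptional set accommodates the jump times of a piecewise continuous choice. -/
theorem le_of_hasDerivAt_nonpos_off_finite {f f' : ℝ → ℝ} {S : Set ℝ} (hS : S.Finite) :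
    ∀ {a b : ℝ}, a ≤ b → ContinuousOn f (Icc a b) →
      (∀ x ∈ Ioo a b, x ∉ S → HasDerivAt f (f' x) x) →
      (∀ x ∈ Ioo a b, x ∉ S → f' x ≤ 0) → f b ≤ f a := by
  induction S, hS using Set.Finite.induction_on with
  | empty =>
    intro a b hab hf hd hn
    refine antitoneOn_of_deriv_nonpos (convex_Icc a b) hf ?_ ?_ (left_mem_Icc.2 hab)
      (right_mem_Icc.2 hab) hab
    · rw [interior_Icc]
      exact fun x hx => (hd x hx (by simp)).differentiableAt.differentiableWithinAt
    · rw [interior_Icc]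
      intro x hx
      rw [(hd x hx (by simp)).deriv]
      exact hn x hx (by simp)
  | @insert c S _ _ ih =>
    intro a b hab hf hd hn
    by_cases hc : c ∈ Ioo a b
    · refine (ih hc.2.le (hf.mono (Icc_subset_Icc_left hc.1.le)) ?_ ?_).trans
        (ih hc.1.le (hf.mono (Icc_subset_Icc_right hc.2.le)) ?_ ?_)
      · exact fun x hx hxS => hd x ⟨hc.1.trans hx.1, hx.2⟩ (by simp [hx.1.ne', hxS])
      · exact fun x hx hxS => hn x ⟨hc.1.trans hx.1, hx.2⟩ (by simp [hx.1.ne', hxS])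
      · exact fun x hx hxS => hd x ⟨hx.1, hx.2.trans hc.2⟩ (by simp [hx.2.ne, hxS])
      · exact fun x hx hxS => hn x ⟨hx.1, hx.2.trans hc.2⟩ (by simp [hx.2.ne, hxS])
    · have hne : ∀ x ∈ Ioo a b, x ≠ c := fun x hx h => hc (h ▸ hx)
      exact ih hab hf (fun x hx hxS => hd x hx (by simp [hne x hx, hxS]))
        (fun x hx hxS => hn x hx (by simp [hne x hx, hxS]))

/-- Global existence for a vector field that is Lipschitz in space and bounded over bounded times.
Over `[-n - 1, n + 1]` Picard–Lindelöf applies in one step on a large ball; the solutions are glued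
by uniqueness. -/
theorem exists_hasDerivAt_of_lipschitz {E : Type*} [NormedAddCommGroup E] [NormedSpace ℝ E]
    [CompleteSpace E] {f : ℝ → E → E} {K : ℝ≥0} (hK : ∀ t, LipschitzWith K (f t))
    (hc : ∀ x, Continuous fun t => f t x) (hb : ∀ T : ℝ, ∃ C : ℝ≥0, ∀ t, |t| ≤ T → ∀ x, ‖f t x‖ ≤ C)
    (x₀ : E) : ∃ x : ℝ → E, x 0 = x₀ ∧ ∀ t, HasDerivAt x (f t (x t)) t := by
  have hloc : ∀ n : ℕ, ∃ x : ℝ → E, x 0 = x₀ ∧ ∀ t ∈ Ioo (-(n : ℝ) - 1) (n + 1),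
      HasDerivAt x (f t (x t)) t := by
    intro n
    obtain ⟨C, hC⟩ := hb (n + 1)
    have h0 : (0 : ℝ) ∈ Icc (-(n : ℝ) - 1) (n + 1) := by
      constructor <;> linarith [n.cast_nonneg (α := ℝ)]
    have hpl : IsPicardLindelof f (⟨0, h0⟩ : Icc (-(n : ℝ) - 1) (n + 1)) x₀
        (C * (n + 1)) 0 C K :=
      { lipschitzOnWith := fun t _ => (hK t).lipschitzOnWith
        continuousOn := fun x _ => (hc x).continuousOn
        norm_le := fun t ht x _ => hC t (abs_le.2 ⟨by linarith [ht.1], ht.2⟩) x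
        mul_max_le := by
          have : max ((n : ℝ) + 1 - 0) (0 - (-(n : ℝ) - 1)) = n + 1 := by
            rw [max_eq_left] <;> linarith
          simp only [this]
          push_cast
          simp }
    obtain ⟨x, hx0, hx⟩ := hpl.exists_eq_forall_mem_Icc_hasDerivWithinAt₀
    exact ⟨x, hx0, fun t ht => (hx t (Ioo_subset_Icc_self ht)).hasDerivAt (Icc_mem_nhds ht.1 ht.2)⟩
  choose X hX0 hX using hloc
  have huniq : ∀ {m n : ℕ}, m ≤ n → EqOn (X m) (X n) (Ioo (-(m : ℝ) - 1) (m + 1)) := by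
    intro m n hmn
    have hmn' : (m : ℝ) ≤ n := by exact_mod_cast hmn
    refine ODE_solution_unique_of_mem_Ioo (v := f) (s := fun _ => univ) (t₀ := 0)
      (fun t _ => (hK t).lipschitzOnWith) ?_ (fun t ht => ⟨hX m t ht, mem_univ _⟩)
      (fun t ht => ⟨hX n t ⟨by linarith [ht.1], by linarith [ht.2]⟩, mem_univ _⟩) ?_
    · constructor <;> linarith [m.cast_nonneg (α := ℝ)]
    · rw [hX0, hX0]
  have hmem : ∀ t : ℝ, t ∈ Ioo (-(⌊|t|⌋₊ : ℝ) - 1) (⌊|t|⌋₊ + 1) := by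
    intro t
    have := Nat.lt_floor_add_one |t|
    exact ⟨by linarith [neg_abs_le t], by linarith [le_abs_self t]⟩
  have heq : ∀ (n : ℕ), ∀ t ∈ Ioo (-(n : ℝ) - 1) (n + 1), X ⌊|t|⌋₊ t = X n t := by
    intro n t ht
    rcases le_total ⌊|t|⌋₊ n with h | h
    · exact huniq h (hmem t)
    · exact (huniq h ht).symm
  refine ⟨fun t => X ⌊|t|⌋₊ t, by simp [hX0], fun t => ?_⟩
  have h1 := hX _ t (hmem t)
  refine h1.congr_of_eventuallyEq ?_
  filter_upwards [Ioo_mem_nhds (hmem t).1 (hmem t).2] with s hs using heq _ s hs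

/-- Truncation of every coordinate to `[a, b]`. -/
def clip {ι : Type*} (a b : ℝ) (v : ι → ℝ) : ι → ℝ := fun i => max a (min b (v i))

theorem lipschitzWith_clip {ι : Type*} [Fintype ι] (a b : ℝ) :
    LipschitzWith 1 (clip a b : (ι → ℝ) → ι → ℝ) := by
  refine LipschitzWith.of_dist_le_mul fun v w => ?_
  rw [NNReal.coe_one, one_mul]
  refine (dist_pi_le_iff dist_nonneg).2 fun i => le_trans ?_ (dist_le_pi_dist v w i)
  simp only [clip, Real.dist_eq]
  calc |max a (min b (v i)) - max a (min b (w i))|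
      ≤ |min b (v i) - min b (w i)| := by
        simpa using abs_max_sub_max_le_max a (min b (v i)) a (min b (w i))
    _ ≤ |v i - w i| := by simpa using abs_min_sub_min_le_max b (v i) b (w i)

/-- Global existence for a linear equation with bounded continuous coefficients. The field is made
bounded by truncating the coordinates at the a priori Grönwall bound `‖x₀‖ * exp (L * |t|)`, which
the solution then respects. -/
theorem exists_hasDerivAt_linear {ι : Type*} [Fintype ι] {B : ℝ → ι → ι → ℝ} {C : ℝ} (hC0 : 0 ≤ C)
    (hB : ∀ i l, Continuous fun t => B t i l) (hC : ∀ t i l, |B t i l| ≤ C) (x₀ : ι → ℝ) :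
    ∃ x : ℝ → ι → ℝ, x 0 = x₀ ∧ Continuous x ∧
      ∀ t, 0 ≤ t → HasDerivAt x (fun i => ∑ l, B t i l * x t l) t := by
  set L : ℝ≥0 := Fintype.card ι * C.toNNReal with hL
  have hLc : (L : ℝ) = Fintype.card ι * C := by
    rw [hL, NNReal.coe_mul, NNReal.coe_natCast, Real.coe_toNNReal C hC0]
  have hlin : ∀ t (v : ι → ℝ), ‖fun i => ∑ l, B t i l * v l‖ ≤ L * ‖v‖ := by
    intro t v
    refine (pi_norm_le_iff_of_nonneg (by positivity)).2 fun i => ?_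
    calc ‖∑ l, B t i l * v l‖ ≤ ∑ l, ‖B t i l * v l‖ := norm_sum_le _ _
      _ ≤ ∑ _l : ι, C * ‖v‖ := by
          refine Finset.sum_le_sum fun l _ => ?_
          rw [norm_mul]
          exact mul_le_mul (hC t i l) (norm_le_pi_norm v l) (norm_nonneg _) hC0
      _ = L * ‖v‖ := by simp [hLc, mul_assoc]
  set R : ℝ → ℝ := fun t => ‖x₀‖ * Real.exp (L * |t|) with hR
  have hR0 : ∀ t, 0 ≤ R t := fun t => by positivity
  have hclip : ∀ t (v : ι → ℝ), ‖clip (-R t) (R t) v‖ ≤ R t := by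
    intro t v
    refine (pi_norm_le_iff_of_nonneg (hR0 t)).2 fun i => ?_
    rw [Real.norm_eq_abs, abs_le]
    exact ⟨le_max_left _ _, max_le (by linarith [hR0 t]) (min_le_left _ _)⟩
  have hclip' : ∀ t (v : ι → ℝ), ‖clip (-R t) (R t) v‖ ≤ ‖v‖ := by
    intro t v
    refine (pi_norm_le_iff_of_nonneg (norm_nonneg v)).2 fun i => ?_
    have h := norm_le_pi_norm v i
    rw [Real.norm_eq_abs, abs_le] at h ⊢
    refine ⟨?_, max_le ?_ ((min_le_right _ _).trans h.2)⟩
    · rcases le_total (R t) (v i) with h1 | h1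
      · exact le_max_of_le_right (by rw [min_eq_left h1]; linarith [hR0 t, norm_nonneg v])
      · exact le_max_of_le_right (by rw [min_eq_right h1]; exact h.1)
    · linarith [hR0 t, norm_nonneg v]
  -- Truncation at the radius `R t` leaves the solution unchanged and makes the field bounded.
  have hLip : ∀ t, LipschitzWith L fun (v : ι → ℝ) i => ∑ l, B t i l * clip (-R t) (R t) v l := by
    intro t
    refine LipschitzWith.of_dist_le_mul fun v w => ?_
    rw [dist_eq_norm, dist_eq_norm]
    have : ((fun i => ∑ l, B t i l * clip (-R t) (R t) v l) -
        fun i => ∑ l, B t i l * clip (-R t) (R t) w l) =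
        fun i => ∑ l, B t i l * (clip (-R t) (R t) v - clip (-R t) (R t) w) l := by
      funext i
      simp [mul_sub, Finset.sum_sub_distrib]
    rw [this]
    refine (hlin t _).trans (mul_le_mul_of_nonneg_left ?_ L.2)
    simpa [dist_eq_norm] using (lipschitzWith_clip (-R t) (R t)).dist_le_mul v w
  have hcont : ∀ v : ι → ℝ, Continuous fun t => fun i => ∑ l, B t i l * clip (-R t) (R t) v l := by
    intro v
    have hRc : Continuous R := by fun_prop
    refine continuous_pi fun i => continuous_finsetSum _ fun l _ => (hB i l).mul ?_
    exact hRc.neg.max (hRc.min continuous_const)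
  have hbd : ∀ T : ℝ, ∃ C' : ℝ≥0, ∀ t, |t| ≤ T → ∀ v : ι → ℝ,
      ‖fun i => ∑ l, B t i l * clip (-R t) (R t) v l‖ ≤ C' := by
    intro T
    refine ⟨⟨L * (‖x₀‖ * Real.exp (L * T)), by positivity⟩, fun t ht v => ?_⟩
    refine (hlin t _).trans (mul_le_mul_of_nonneg_left ((hclip t v).trans ?_) L.2)
    exact mul_le_mul_of_nonneg_left (Real.exp_le_exp.2 (mul_le_mul_of_nonneg_left ht L.2))
      (norm_nonneg _)
  obtain ⟨x, hx0, hx⟩ := exists_hasDerivAt_of_lipschitz hLip hcont hbd x₀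
  have hxc : Continuous x := continuous_iff_continuousAt.2 fun t => (hx t).continuousAt
  refine ⟨x, hx0, hxc, fun t ht => ?_⟩
  have hbound : ‖x t‖ ≤ R t := by
    have := norm_le_gronwallBound_of_norm_deriv_right_le (f := x) (a := 0) (b := t) (δ := ‖x₀‖)
      (K := L) (ε := 0) hxc.continuousOn (fun s _ => (hx s).hasDerivWithinAt) (by rw [hx0])
      (fun s _ => by
        rw [add_zero]
        exact (hlin s _).trans (mul_le_mul_of_nonneg_left (hclip' s _) L.2)) t ⟨ht, le_rfl⟩
    rw [gronwallBound_ε0, sub_zero] at this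
    simpa only [hR, abs_of_nonneg ht] using this
  have : clip (-R t) (R t) (x t) = x t := by
    funext i
    have h := (norm_le_pi_norm (x t) i).trans hbound
    rw [Real.norm_eq_abs, abs_le] at h
    simp only [clip]
    rw [min_eq_right h.2, max_eq_right h.1]
  have h := hx t
  simpa only [this] using h

/-! ### Markov chains in a time-dependent environment -/

/-- `A` is the generator of a Markov chain on the objects, with entries bounded by `C`. -/
structure IsGenerator (A : Obj → Obj → ℝ) (C : ℝ) : Prop where
  nonneg : ∀ j k, j ≠ k → 0 ≤ A j k
  row_sum : ∀ j, ∑ k, A j k = 0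
  abs_le : ∀ j k, |A j k| ≤ C

theorem hasDerivAt_min_zero_sq (x : ℝ) :
    HasDerivAt (fun y : ℝ => min y 0 ^ 2) (2 * min x 0) x := by
  have hpos : ∀ {x : ℝ}, 0 < x → HasDerivAt (fun y : ℝ => min y 0 ^ 2) 0 x := by
    intro x h
    refine (hasDerivAt_const x (0 : ℝ)).congr_of_eventuallyEq ?_
    filter_upwards [lt_mem_nhds h] with y hy
    simp [min_eq_right hy.le]
  rcases lt_trichotomy x 0 with h | h | h
  · have : HasDerivAt (fun y : ℝ => y ^ 2) (2 * x) x := by simpa using hasDerivAt_pow 2 x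
    rw [min_eq_left h.le]
    refine this.congr_of_eventuallyEq ?_
    filter_upwards [gt_mem_nhds h] with y hy
    rw [min_eq_left (le_of_lt hy)]
  · subst h
    rw [min_self, mul_zero, hasDerivAt_iff_isLittleO_nhds_zero]
    have h1 : (fun h : ℝ => min (0 + h) 0 ^ 2 - min (0 : ℝ) 0 ^ 2 - h • (0 : ℝ)) =O[𝓝 0]
        fun h : ℝ => h ^ 2 := by
      refine Asymptotics.IsBigO.of_bound 1 (Eventually.of_forall fun h => ?_)
      simp only [zero_add, min_self, smul_zero, sub_zero, Real.norm_eq_abs, one_mul, abs_pow]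
      norm_num
      rcases le_total h 0 with h' | h'
      · simp [min_eq_left h']
      · simp [min_eq_right h', sq_nonneg]
    refine h1.trans_isLittleO ?_
    simpa using Asymptotics.isLittleO_pow_id (𝕜 := ℝ) (n := 2) (by norm_num)
  · rw [min_eq_right h.le, mul_zero]
    exact hpos h

section Transition

variable {A : ℝ → Obj → Obj → ℝ} {C t : ℝ} {j : Obj} {π : ℝ → Obj → ℝ}

/-- Differential inequality for the squared negative part of a solution of the forward equation
with generator `B`. -/
theorem sum_min_zero_mul_le {B : Obj → Obj → ℝ} (hB : IsGenerator B C) (q : Obj → ℝ) :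
    ∑ k, 2 * min (q k) 0 * ∑ l, B l k * q l ≤ 8 * C * ∑ k, min (q k) 0 ^ 2 := by
  set m : Obj → ℝ := fun k => min (q k) 0 with hm
  have hm0 : ∀ k, m k ≤ 0 := fun k => min_le_right _ _
  have key : ∀ k l, m k * (B l k * q l) ≤ C * ((m k ^ 2 + m l ^ 2) / 2) := by
    intro k l
    have h1 : m k * (B l k * q l) ≤ B l k * (m k * m l) := by
      by_cases h : l = k
      · subst h
        rcases le_total (q l) 0 with h' | h'
        · rw [show m l = q l from min_eq_left h']; linarith
        · rw [show m l = 0 from min_eq_right h']; simp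
      · have h2 : m l ≤ q l := min_le_left _ _
        nlinarith [mul_nonneg (mul_nonneg (hB.nonneg l k h) (neg_nonneg.2 (hm0 k)))
          (sub_nonneg.2 h2)]
    have h3 : 0 ≤ m k * m l := mul_nonneg_of_nonpos_of_nonpos (hm0 k) (hm0 l)
    have h4 := (le_abs_self _).trans (hB.abs_le l k)
    have hC := (abs_nonneg _).trans (hB.abs_le l k)
    calc m k * (B l k * q l) ≤ B l k * (m k * m l) := h1
      _ ≤ C * (m k * m l) := mul_le_mul_of_nonneg_right h4 h3
      _ ≤ _ := mul_le_mul_of_nonneg_left (by nlinarith [sq_nonneg (m k - m l)]) hC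
  calc ∑ k, 2 * m k * ∑ l, B l k * q l = 2 * ∑ k, ∑ l, m k * (B l k * q l) := by
        simp only [Finset.mul_sum, mul_assoc]
    _ ≤ 2 * ∑ k, ∑ l, C * ((m k ^ 2 + m l ^ 2) / 2) := by
        refine mul_le_mul_of_nonneg_left ?_ zero_le_two
        exact Finset.sum_le_sum fun k _ => Finset.sum_le_sum fun l _ => key k l
    _ = 8 * C * ∑ k, m k ^ 2 := by
        simp only [← Finset.mul_sum, ← Finset.sum_div, Finset.sum_add_distrib, Finset.sum_const,
          Finset.card_univ, Fintype.card_option, Fintype.card_fin]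
        simp only [nsmul_eq_mul, ← Finset.mul_sum]
        push_cast
        ring

/-- Transition probabilities are nonnegative: the squared norm of their negative part, weighted by
`exp (-8 C s)`, starts at zero and does not increase. -/
theorem IsTransition.nonneg (hA : ∀ τ, t < τ → IsGenerator (A τ) C)
    (hfin : ∀ T, {τ | τ ∈ Ioo t T ∧ ¬ ContinuousAt A τ}.Finite) (hπ : IsTransition A t j π)
    {τ : ℝ} (hτ : t ≤ τ) (k : Obj) : 0 ≤ π τ k := by
  obtain ⟨hc, h0, hd⟩ := hπ
  have hck : ∀ k, ContinuousOn (fun s => π s k) (Icc t τ) := fun k =>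
    ((continuous_apply k).comp_continuousOn hc).mono Icc_subset_Ici_self
  have hle := le_of_hasDerivAt_nonpos_off_finite
    (f := fun s => Real.exp (-(8 * C) * s) * ∑ k, min (π s k) 0 ^ 2)
    (f' := fun s => Real.exp (-(8 * C) * s) * (-(8 * C)) * (∑ k, min (π s k) 0 ^ 2) +
      Real.exp (-(8 * C) * s) * ∑ k, 2 * min (π s k) 0 * ∑ l, A s l k * π s l)
    (hfin τ) hτ ?_ ?_ ?_
  · have hz : ∑ k, min (π t k) 0 ^ 2 = 0 := by
      refine Finset.sum_eq_zero fun k _ => ?_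
      rw [h0 k]
      split_ifs <;> simp
    simp only [hz, mul_zero] at hle
    have h1 : ∑ k, min (π τ k) 0 ^ 2 ≤ 0 := nonpos_of_mul_nonpos_right hle (Real.exp_pos _)
    have h2 : min (π τ k) 0 ^ 2 ≤ 0 := le_trans
      (Finset.single_le_sum (f := fun k => min (π τ k) 0 ^ 2) (fun k _ => sq_nonneg _)
        (Finset.mem_univ k)) h1
    have h3 : min (π τ k) 0 = 0 := by
      have := le_antisymm h2 (sq_nonneg _)
      exact pow_eq_zero_iff (two_ne_zero) |>.1 this
    exact min_eq_right_iff.1 h3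
  · refine ContinuousOn.mul (by fun_prop) (continuousOn_finsetSum _ fun k _ => ?_)
    exact ((continuous_id.min continuous_const).comp_continuousOn (hck k)).pow 2
  · intro s hs hsS
    have hAs : ContinuousAt A s := by
      by_contra h
      exact hsS ⟨hs, h⟩
    have hπs := hasDerivAt_pi.1 (hd s hs.1 hAs)
    have he : HasDerivAt (fun s => Real.exp (-(8 * C) * s))
        (Real.exp (-(8 * C) * s) * (-(8 * C))) s := by
      simpa using ((hasDerivAt_id s).const_mul (-(8 * C))).exp
    refine he.mul ?_
    refine HasDerivAt.fun_sum fun k _ => ?_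
    exact (hasDerivAt_min_zero_sq (π s k)).comp s (hπs k)
  · intro s hs _
    have := sum_min_zero_mul_le (hA s hs.1) (π s)
    nlinarith [mul_le_mul_of_nonneg_left this (Real.exp_pos (-(8 * C) * s)).le]

theorem IsTransition.sum_eq_one (hA : ∀ τ, t < τ → IsGenerator (A τ) C)
    (hfin : ∀ T, {τ | τ ∈ Ioo t T ∧ ¬ ContinuousAt A τ}.Finite) (hπ : IsTransition A t j π)
    {τ : ℝ} (hτ : t ≤ τ) : ∑ k, π τ k = 1 := by
  obtain ⟨hc, h0, hd⟩ := hπ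
  have hcs : ContinuousOn (fun s => ∑ k, π s k) (Icc t τ) :=
    continuousOn_finsetSum _ fun k _ =>
      ((continuous_apply k).comp_continuousOn hc).mono Icc_subset_Ici_self
  have hds : ∀ s ∈ Ioo t τ, s ∉ {s | s ∈ Ioo t τ ∧ ¬ ContinuousAt A s} →
      HasDerivAt (fun s => ∑ k, π s k) 0 s := by
    intro s hs hsS
    have hAs : ContinuousAt A s := by
      by_contra h
      exact hsS ⟨hs, h⟩
    have h := HasDerivAt.fun_sum fun k (_ : k ∈ Finset.univ) =>
      hasDerivAt_pi.1 (hd s hs.1 hAs) k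
    have hz : ∑ k, ∑ l, A s l k * π s l = 0 := by
      rw [Finset.sum_comm]
      simp only [← Finset.sum_mul, (hA s hs.1).row_sum, zero_mul, Finset.sum_const_zero]
    rwa [hz] at h
  have h1 := le_of_hasDerivAt_nonpos_off_finite (f' := fun _ => 0) (hfin τ) hτ hcs hds
    (fun _ _ _ => le_rfl)
  have h2 := le_of_hasDerivAt_nonpos_off_finite (f' := fun _ => -0) (hfin τ) hτ hcs.neg
    (fun s hs hsS => (hds s hs hsS).neg) (fun _ _ _ => by simp)
  have h3 : ∑ k, π t k = 1 := by simp [h0]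
  simp only [Pi.neg_apply] at h2
  linarith

theorem abs_sum_mul_le_of_prob {q v : Obj → ℝ} {B : ℝ} (hq : ∀ k, 0 ≤ q k) (hs : ∑ k, q k = 1)
    (hv : ∀ k, |v k| ≤ B) : |∑ k, q k * v k| ≤ B := by
  calc |∑ k, q k * v k| ≤ ∑ k, |q k * v k| := Finset.abs_sum_le_sum_abs _ _
    _ ≤ ∑ k, q k * B := by
        refine Finset.sum_le_sum fun k _ => ?_
        rw [abs_mul, abs_of_nonneg (hq k)]
        exact mul_le_mul_of_nonneg_left (hv k) (hq k)
    _ = B := by rw [← Finset.sum_mul, hs, one_mul]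

variable {r : ℝ → Obj → ℝ} {ρ : ℝ}

theorem integrableOn_exp_mul_of_bounded {g : ℝ → ℝ} {B : ℝ} (hρ : 0 < ρ)
    (hg : ContinuousOn g (Ici t)) (hB : ∀ τ, t ≤ τ → |g τ| ≤ B) :
    IntegrableOn (fun τ => Real.exp (-ρ * (τ - t)) * g τ) (Ioi t) := by
  have hi : IntegrableOn (fun τ => Real.exp (-ρ * (τ - t)) * B) (Ioi t) := by
    have h : IntegrableOn (fun τ => Real.exp (-ρ * τ) * (Real.exp (ρ * t) * B)) (Ioi t) :=
      (exp_neg_integrableOn_Ioi t hρ).mul_const (Real.exp (ρ * t) * B)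
    refine IntegrableOn.congr_fun h (fun τ _ => ?_) measurableSet_Ioi
    rw [← mul_assoc, ← Real.exp_add]
    ring_nf
  refine Integrable.mono' hi ?_ ?_
  · refine ContinuousOn.aestronglyMeasurable ?_ measurableSet_Ioi
    exact ContinuousOn.mul (by fun_prop) (hg.mono Ioi_subset_Ici_self)
  · refine (ae_restrict_iff' measurableSet_Ioi).2 (Eventually.of_forall fun τ hτ => ?_)
    rw [norm_mul, Real.norm_eq_abs, Real.norm_eq_abs, abs_of_pos (Real.exp_pos _)]
    exact mul_le_mul_of_nonneg_left (hB τ (le_of_lt hτ)) (Real.exp_pos _).le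

theorem IsTransition.integrableOn {B : ℝ} (hρ : 0 < ρ) (hA : ∀ τ, t < τ → IsGenerator (A τ) C)
    (hfin : ∀ T, {τ | τ ∈ Ioo t T ∧ ¬ ContinuousAt A τ}.Finite) (hπ : IsTransition A t j π)
    (hr : ∀ l, ContinuousOn (fun τ => r τ l) (Ici t)) (hB : ∀ τ, t ≤ τ → ∀ l, |r τ l| ≤ B) :
    IntegrableOn (fun τ => Real.exp (-ρ * (τ - t)) * ∑ l, π τ l * r τ l) (Ioi t) := by
  refine integrableOn_exp_mul_of_bounded hρ ?_ fun τ hτ => abs_sum_mul_le_of_prob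
    (fun k => hπ.nonneg hA hfin hτ k) (hπ.sum_eq_one hA hfin hτ) (hB τ hτ)
  exact continuousOn_finsetSum _ fun l _ => ((continuous_apply l).comp_continuousOn hπ.1).mul (hr l)

/-- If `U` is a bounded supersolution of the Bellman equation with generator `A` and flow `r`, then
`U t j` bounds the expected discounted flow from state `j` at time `t`: the discounted expectation
of `U` plus the flow collected so far does not increase. -/
theorem IsTransition.integral_le {U U' : ℝ → Obj → ℝ} {B : ℝ} (hρ : 0 < ρ)
    (hA : ∀ τ, t < τ → IsGenerator (A τ) C)
    (hfin : ∀ T, {τ | τ ∈ Ioo t T ∧ ¬ ContinuousAt A τ}.Finite) (hπ : IsTransition A t j π)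
    (hr : ∀ l, ContinuousOn (fun τ => r τ l) (Ici t))
    (hi : IntegrableOn (fun τ => Real.exp (-ρ * (τ - t)) * ∑ l, π τ l * r τ l) (Ioi t))
    (hUc : ∀ l, ContinuousOn (fun τ => U τ l) (Ici t))
    (hU : ∀ τ, t < τ → ∀ l, HasDerivAt (fun τ => U τ l) (U' τ l) τ)
    (hB : ∀ τ, t ≤ τ → ∀ l, |U τ l| ≤ B)
    (hle : ∀ τ, t < τ → ∀ l, U' τ l - ρ * U τ l + ∑ k, A τ l k * U τ k + r τ l ≤ 0) :
    ∫ τ in Ioi t, Real.exp (-ρ * (τ - t)) * ∑ l, π τ l * r τ l ≤ U t j := by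
  set g : ℝ → ℝ := fun τ => Real.exp (-ρ * (τ - t)) * ∑ l, π τ l * r τ l with hg
  have hπc : ∀ l, ContinuousOn (fun τ => π τ l) (Ici t) := fun l =>
    (continuous_apply l).comp_continuousOn hπ.1
  have hgc : ContinuousOn g (Ici t) :=
    ContinuousOn.mul (by fun_prop) (continuousOn_finsetSum _ fun l _ => (hπc l).mul (hr l))
  have hgi : ∀ {T}, t ≤ T → IntervalIntegrable g volume t T := fun {T} hT =>
    (hgc.mono (by rw [uIcc_of_le hT]; exact Icc_subset_Ici_self)).intervalIntegrable
  have step : ∀ T, t ≤ T →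
      Real.exp (-ρ * (T - t)) * (∑ l, π T l * U T l) + ∫ τ in t..T, g τ ≤ U t j := by
    intro T hT
    have h := le_of_hasDerivAt_nonpos_off_finite
      (f := fun T => Real.exp (-ρ * (T - t)) * (∑ l, π T l * U T l) + ∫ τ in t..T, g τ)
      (f' := fun s => (Real.exp (-ρ * (s - t)) * (-ρ) * (∑ l, π s l * U s l) +
        Real.exp (-ρ * (s - t)) * ∑ l, ((∑ k, A s k l * π s k) * U s l + π s l * U' s l)) + g s)
      (hfin T) hT ?_ ?_ ?_
    · simpa [hπ.2.1] using h
    · refine ContinuousOn.add (ContinuousOn.mul (by fun_prop)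
        (continuousOn_finsetSum _ fun l _ => ?_)) ?_
      · exact ((hπc l).mul (hUc l)).mono Icc_subset_Ici_self
      · have := intervalIntegral.continuousOn_primitive_interval (μ := volume) (f := g) (a := t)
          (b := T) (by
            rw [uIcc_of_le hT]
            exact (hgc.mono Icc_subset_Ici_self).integrableOn_Icc)
        rwa [uIcc_of_le hT] at this
    · intro s hs hsS
      have hAs : ContinuousAt A s := by
        by_contra h
        exact hsS ⟨hs, h⟩
      have he : HasDerivAt (fun s => Real.exp (-ρ * (s - t)))
          (Real.exp (-ρ * (s - t)) * (-ρ)) s := by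
        simpa using (((hasDerivAt_id s).sub_const t).const_mul (-ρ)).exp
      refine (he.mul (HasDerivAt.fun_sum fun l _ =>
        (hasDerivAt_pi.1 (hπ.2.2 s hs.1 hAs) l).mul (hU s hs.1 l))).add ?_
      refine intervalIntegral.integral_hasDerivAt_right (hgi hs.1.le) ?_
        (hgc.continuousAt (Ici_mem_nhds hs.1))
      exact (hgc.mono Ioi_subset_Ici_self).stronglyMeasurableAtFilter isOpen_Ioi s hs.1
    · intro s hs _
      have hswap : ∑ l, (∑ k, A s k l * π s k) * U s l = ∑ l, π s l * ∑ k, A s l k * U s k := by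
        simp only [Finset.sum_mul, Finset.mul_sum]
        rw [Finset.sum_comm]
        refine Finset.sum_congr rfl fun k _ => Finset.sum_congr rfl fun l _ => by ring
      have hall : ∑ l, π s l * (U' s l - ρ * U s l + ∑ k, A s l k * U s k + r s l) ≤ 0 :=
        Finset.sum_nonpos fun l _ => mul_nonpos_of_nonneg_of_nonpos
          (hπ.nonneg hA hfin hs.1.le l) (hle s hs.1 l)
      have hexp : ∑ l, π s l * (U' s l - ρ * U s l + ∑ k, A s l k * U s k + r s l) =
          (∑ l, π s l * U' s l) - ρ * (∑ l, π s l * U s l) +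
            (∑ l, π s l * ∑ k, A s l k * U s k) + ∑ l, π s l * r s l := by
        rw [Finset.mul_sum, ← Finset.sum_sub_distrib, ← Finset.sum_add_distrib,
          ← Finset.sum_add_distrib]
        exact Finset.sum_congr rfl fun l _ => by ring
      rw [Finset.sum_add_distrib, hswap, hg]
      have := mul_nonpos_of_nonneg_of_nonpos (Real.exp_pos (-ρ * (s - t))).le (hexp ▸ hall)
      linarith
  have hlim : Tendsto (fun T => Real.exp (-ρ * (T - t)) * (∑ l, π T l * U T l) +
      ∫ τ in t..T, g τ) atTop (𝓝 (0 + ∫ τ in Ioi t, g τ)) := by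
    refine Tendsto.add ?_ (intervalIntegral_tendsto_integral_Ioi t hi tendsto_id)
    have hexp : Tendsto (fun T => Real.exp (-ρ * (T - t))) atTop (𝓝 0) := by
      refine Real.tendsto_exp_atBot.comp ?_
      exact (tendsto_atTop_add_const_right _ (-t) tendsto_id).const_mul_atTop_of_neg
        (neg_lt_zero.2 hρ)
    refine squeeze_zero_norm' (a := fun T => Real.exp (-ρ * (T - t)) * B) ?_
      (by simpa using hexp.mul_const B)
    filter_upwards [eventually_ge_atTop t] with T hT
    rw [norm_mul, Real.norm_eq_abs, Real.norm_eq_abs, abs_of_pos (Real.exp_pos _)]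
    exact mul_le_mul_of_nonneg_left (abs_sum_mul_le_of_prob (fun k => hπ.nonneg hA hfin hT k)
      (hπ.sum_eq_one hA hfin hT) (hB T hT)) (Real.exp_pos _).le
  rw [zero_add] at hlim
  exact le_of_tendsto hlim (by filter_upwards [eventually_ge_atTop t] with T hT using step T hT)

end Transition

/-! ### Values as solutions of the backward equation -/

/-- The fundamental solutions of the forward equation `Φ' = Φ A` and of the backward equation
`Ψ' = -A Ψ` are inverse to each other, so `Ψ t * Φ τ` is the transition matrix from `t` to `τ`. -/
theorem exists_inverse_fundamental_solutions {A : ℝ → Obj → Obj → ℝ} {C : ℝ}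
    (hAc : ∀ j k, Continuous fun t => A t j k) (hC : ∀ t j k, |A t j k| ≤ C) :
    ∃ Φ Ψ : ℝ → Obj → Obj → ℝ,
      (∀ k l, Continuous fun t => Φ t k l) ∧ (∀ j k, Continuous fun t => Ψ t j k) ∧
      (∀ k l, Φ 0 k l = if l = k then 1 else 0) ∧ (∀ j k, Ψ 0 j k = if j = k then 1 else 0) ∧
      (∀ t, 0 ≤ t → ∀ k l, HasDerivAt (fun t => Φ t k l) (∑ m, A t m l * Φ t k m) t) ∧
      (∀ t, 0 ≤ t → ∀ j k, HasDerivAt (fun t => Ψ t j k) (-∑ m, A t j m * Ψ t m k) t) ∧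
      ∀ t, 0 ≤ t → ∀ j l, ∑ k, Ψ t j k * Φ t k l = if l = j then 1 else 0 := by
  have hC0 : 0 ≤ C := (abs_nonneg _).trans (hC 0 none none)
  choose φ hφ0 hφc hφ using fun k : Obj => exists_hasDerivAt_linear
    (B := fun t l m => A t m l) hC0 (fun l m => hAc m l) (fun t l m => hC t m l)
    (fun l => if l = k then 1 else 0)
  choose ψ hψ0 hψc hψ using fun k : Obj => exists_hasDerivAt_linear
    (B := fun t j m => -A t j m) hC0 (fun j m => (hAc j m).neg)
    (fun t j m => by rw [abs_neg]; exact hC t j m) (fun j => if j = k then 1 else 0)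
  have hΦ : ∀ t, 0 ≤ t → ∀ k l, HasDerivAt (fun t => φ k t l) (∑ m, A t m l * φ k t m) t :=
    fun t ht k l => hasDerivAt_pi.1 (hφ k t ht) l
  have hΨ : ∀ t, 0 ≤ t → ∀ j k, HasDerivAt (fun t => ψ k t j) (-∑ m, A t j m * ψ k t m) t := by
    intro t ht j k
    simpa only [neg_mul, Finset.sum_neg_distrib] using hasDerivAt_pi.1 (hψ k t ht) j
  refine ⟨fun t k l => φ k t l, fun t j k => ψ k t j, fun k l => (continuous_apply l).comp (hφc k),
    fun j k => (continuous_apply j).comp (hψc k), fun k l => by simp [hφ0],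
    fun j k => by simp [hψ0], hΦ, hΨ, fun t ht j l => ?_⟩
  have hconst : ∀ s, 0 ≤ s → ∀ k l, ∑ m, φ k s m * ψ l s m = if k = l then 1 else 0 := by
    intro s hs k l
    have hd : ∀ τ, 0 ≤ τ → HasDerivAt (fun τ => ∑ m, φ k τ m * ψ l τ m) 0 τ := by
      intro τ hτ
      have h := HasDerivAt.fun_sum fun m (_ : m ∈ Finset.univ) => (hΦ τ hτ k m).mul (hΨ τ hτ m l)
      have hz : ∑ m, ((∑ n, A τ n m * φ k τ n) * ψ l τ m +
          φ k τ m * -∑ n, A τ m n * ψ l τ n) = 0 := by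
        rw [Finset.sum_add_distrib]
        simp only [mul_neg, Finset.sum_neg_distrib, Finset.sum_mul, Finset.mul_sum]
        rw [Finset.sum_comm, ← sub_eq_add_neg, sub_eq_zero]
        exact Finset.sum_congr rfl fun _ _ => Finset.sum_congr rfl fun _ _ => by ring
      rwa [hz] at h
    have hc : ∀ τ ∈ Icc 0 s, (fun τ => ∑ m, φ k τ m * ψ l τ m) τ =
        (fun τ => ∑ m, φ k τ m * ψ l τ m) 0 :=
      constant_of_has_deriv_right_zero (fun τ hτ => (hd τ hτ.1).continuousAt.continuousWithinAt)
        fun τ hτ => (hd τ hτ.1).hasDerivWithinAt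
    have h := hc s ⟨hs, le_rfl⟩
    simp only [hφ0, hψ0] at h
    rw [h]
    simp [-Fintype.sum_option, eq_comm]
  have hmat : (Matrix.of fun k m => φ k t m) * (Matrix.of fun m l => ψ l t m) = 1 := by
    ext k l
    simp only [Matrix.mul_apply, Matrix.of_apply, Matrix.one_apply]
    exact hconst t ht k l
  rw [mul_eq_one_comm] at hmat
  have h := congrFun (congrFun hmat j) l
  simp only [Matrix.mul_apply, Matrix.of_apply, Matrix.one_apply] at h
  simp only [h, eq_comm]

/-- Transition probabilities exist from every initial time, and the discounted value `W` of the
flow `r` is bounded and solves the Bellman equation `W' = ρ W - r - A W`. -/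
theorem exists_transition_and_value {A : ℝ → Obj → Obj → ℝ} {C : ℝ} {r : ℝ → Obj → ℝ} {B ρ : ℝ}
    (hρ : 0 < ρ) (hAc : ∀ j k, Continuous fun t => A t j k) (hA : ∀ t, IsGenerator (A t) C)
    (hrc : ∀ l, Continuous fun t => r t l) (hB : ∀ t l, |r t l| ≤ B) :
    ∃ (π : ℝ → Obj → ℝ → Obj → ℝ) (W : ℝ → Obj → ℝ),
      (∀ t, 0 ≤ t → ∀ j, IsTransition A t j (π t j) ∧
        IntegrableOn (fun τ => Real.exp (-ρ * (τ - t)) * ∑ l, π t j τ l * r τ l) (Ioi t) ∧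
        W t j = ∫ τ in Ioi t, Real.exp (-ρ * (τ - t)) * ∑ l, π t j τ l * r τ l) ∧
      (∀ t, 0 ≤ t → ∀ j, |W t j| ≤ B / ρ) ∧
      ∀ t, 0 ≤ t → ∀ j, HasDerivAt (fun t => W t j)
        (ρ * W t j - r t j - ∑ k, A t j k * W t k) t := by
  obtain ⟨Φ, Ψ, hΦc, hΨc, hΦ0, hΨ0, hΦ, hΨ, hinv⟩ :=
    exists_inverse_fundamental_solutions hAc fun t => (hA t).abs_le
  have hAcont : Continuous A := continuous_pi fun j => continuous_pi fun k => hAc j k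
  have hfin : ∀ t T, {τ | τ ∈ Ioo t T ∧ ¬ ContinuousAt A τ}.Finite := by
    intro t T
    convert Set.finite_empty
    ext τ
    simp [hAcont.continuousAt]
  set π : ℝ → Obj → ℝ → Obj → ℝ := fun t j τ l => ∑ k, Ψ t j k * Φ τ k l with hπdef
  have hπ : ∀ t, 0 ≤ t → ∀ j, IsTransition A t j (π t j) := by
    intro t ht j
    refine ⟨?_, fun l => hinv t ht j l, fun τ hτ _ => hasDerivAt_pi.2 fun l => ?_⟩
    · exact (continuous_pi fun l => continuous_finsetSum _ fun k _ =>
        continuous_const.mul (hΦc k l)).continuousOn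
    · have h := HasDerivAt.fun_sum fun k (_ : k ∈ Finset.univ) =>
        (hΦ τ (ht.trans hτ.le) k l).const_mul (Ψ t j k)
      refine h.congr_deriv ?_
      simp only [hπdef, Finset.mul_sum]
      rw [Finset.sum_comm]
      exact Finset.sum_congr rfl fun _ _ => Finset.sum_congr rfl fun _ _ => by ring
  have hint : ∀ t, 0 ≤ t → ∀ j, IntegrableOn
      (fun τ => Real.exp (-ρ * (τ - t)) * ∑ l, π t j τ l * r τ l) (Ioi t) := fun t ht j =>
    (hπ t ht j).integrableOn hρ (fun τ _ => hA τ) (hfin t) (fun l => (hrc l).continuousOn)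
      fun τ _ => hB τ
  -- Rewards discounted to time zero along the solution that starts from `k` at time zero.
  set g : Obj → ℝ → ℝ := fun k τ => Real.exp (-ρ * τ) * ∑ l, Φ τ k l * r τ l with hg
  have hgc : ∀ k, Continuous (g k) := fun k =>
    Continuous.mul (by fun_prop) (continuous_finsetSum _ fun l _ => (hΦc k l).mul (hrc l))
  have hgi : ∀ t, 0 ≤ t → ∀ k, IntegrableOn (g k) (Ioi t) := by
    intro t ht k
    refine IntegrableOn.mono_set ?_ (Ioi_subset_Ioi ht)
    refine (hint 0 le_rfl k).congr_fun (fun τ _ => ?_) measurableSet_Ioi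
    simp [hg, hπdef, hΨ0, -Fintype.sum_option]
  set W : ℝ → Obj → ℝ := fun t j => Real.exp (ρ * t) * ∑ k, Ψ t j k * ∫ τ in Ioi t, g k τ with hW
  have hWint : ∀ t, 0 ≤ t → ∀ j,
      W t j = ∫ τ in Ioi t, Real.exp (-ρ * (τ - t)) * ∑ l, π t j τ l * r τ l := by
    intro t ht j
    simp only [hW]
    simp only [← integral_const_mul]
    rw [← integral_finsetSum _ fun k _ => (hgi t ht k).const_mul _, ← integral_const_mul]
    refine setIntegral_congr_fun measurableSet_Ioi fun τ _ => ?_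
    have he : Real.exp (-ρ * (τ - t)) = Real.exp (ρ * t) * Real.exp (-ρ * τ) := by
      rw [← Real.exp_add]; ring_nf
    simp only [hg, hπdef, he, Finset.mul_sum, Finset.sum_mul]
    rw [Finset.sum_comm]
    exact Finset.sum_congr rfl fun _ _ => Finset.sum_congr rfl fun _ _ => by ring
  refine ⟨π, W, fun t ht j => ⟨hπ t ht j, hint t ht j, hWint t ht j⟩, fun t ht j => ?_,
    fun t ht j => ?_⟩
  · have hBρ : ∀ s : ℝ, |s| = 1 → ∫ τ in Ioi t, Real.exp (-ρ * (τ - t)) *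
        ∑ l, π t j τ l * (s * r τ l) ≤ B / ρ := by
      intro s hs
      have hsB : ∀ τ l, |s * r τ l| ≤ B := fun τ l => by rw [abs_mul, hs, one_mul]; exact hB τ l
      have hsc : ∀ l, ContinuousOn (fun τ => s * r τ l) (Ici t) :=
        fun l => ((hrc l).const_mul s).continuousOn
      refine (hπ t ht j).integral_le (r := fun τ l => s * r τ l) (U := fun _ _ => B / ρ)
        (U' := fun _ _ => 0) (B := |B / ρ|) hρ (fun τ _ => hA τ) (hfin t) hsc
        ((hπ t ht j).integrableOn hρ (fun τ _ => hA τ) (hfin t) hsc fun τ _ => hsB τ)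
        (fun _ => continuousOn_const) (fun τ _ l => hasDerivAt_const _ _) (fun _ _ _ => le_rfl) ?_
      intro τ _ l
      rw [← Finset.sum_mul, (hA τ).row_sum, mul_div_cancel₀ _ hρ.ne']
      linarith [(abs_le.1 (hsB τ l)).2]
    have h1 := hBρ 1 (by simp)
    have h2 := hBρ (-1) (by simp)
    simp only [one_mul] at h1
    simp only [neg_mul, one_mul, mul_neg, Finset.sum_neg_distrib, integral_neg] at h2
    rw [hWint t ht j, abs_le]
    simp only [neg_mul] at h1 h2 ⊢
    exact ⟨by linarith, h1⟩
  · have hG : ∀ k, HasDerivAt (fun t => ∫ τ in Ioi t, g k τ) (-g k t) t := by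
      intro k
      have h1 : HasDerivAt (fun s => (∫ τ in Ioi t, g k τ) + ∫ τ in s..t, g k τ) (-g k t) t :=
        (intervalIntegral.integral_hasDerivAt_left ((hgc k).intervalIntegrable _ _)
          (hgc k).aestronglyMeasurable.stronglyMeasurableAtFilter
          (hgc k).continuousAt).const_add _
      refine h1.congr_of_eventuallyEq (Eventually.of_forall fun s => ?_)
      dsimp only
      rw [add_comm, intervalIntegral.integral_interval_add_Ioi' ((hgc k).intervalIntegrable _ _)
        (hgi t ht k)]
    have he : HasDerivAt (fun s => Real.exp (ρ * s)) (Real.exp (ρ * t) * ρ) t := by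
      simpa using ((hasDerivAt_id t).const_mul ρ).exp
    have hr : Real.exp (ρ * t) * ∑ k, Ψ t j k * g k t = r t j := by
      have h1 : ∀ k, Real.exp (ρ * t) * (Ψ t j k * g k t) = ∑ l, Ψ t j k * Φ t k l * r t l := by
        intro k
        have : Real.exp (ρ * t) * Real.exp (-ρ * t) = 1 := by
          rw [← Real.exp_add]; simp
        simp only [hg]
        rw [show Real.exp (ρ * t) * (Ψ t j k * (Real.exp (-ρ * t) * ∑ l, Φ t k l * r t l)) =
          (Real.exp (ρ * t) * Real.exp (-ρ * t)) * (Ψ t j k * ∑ l, Φ t k l * r t l) by ring, this,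
          one_mul, Finset.mul_sum]
        exact Finset.sum_congr rfl fun _ _ => by ring
      rw [Finset.mul_sum, Finset.sum_congr rfl fun k _ => h1 k, Finset.sum_comm]
      simp only [← Finset.sum_mul, hinv t ht]
      simp [-Fintype.sum_option]
    have hAW : ∑ k, A t j k * W t k =
        Real.exp (ρ * t) * ∑ k, (∑ m, A t j m * Ψ t m k) * ∫ τ in Ioi t, g k τ := by
      simp only [hW, Finset.mul_sum, Finset.sum_mul]
      rw [Finset.sum_comm]
      exact Finset.sum_congr rfl fun _ _ => Finset.sum_congr rfl fun _ _ => by ring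
    refine (he.mul (HasDerivAt.fun_sum fun k _ => (hΨ t ht j k).mul (hG k))).congr_deriv ?_
    rw [hAW, ← hr, Finset.sum_add_distrib]
    simp only [hW, Pi.mul_apply, mul_neg, neg_mul, Finset.sum_neg_distrib]
    ring

/-! ### Perturbation of constant values and the resolvent -/

section Transition

variable {A : ℝ → Obj → Obj → ℝ} {C t ρ η : ℝ} {j : Obj} {π r : ℝ → Obj → ℝ}

/-- A constant `U` that is a supersolution up to `η` is one after adding `η / ρ`, as generators
annihilate constants. -/
theorem IsTransition.integral_le_const (hρ : 0 < ρ) (hA : ∀ τ, t < τ → IsGenerator (A τ) C)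
    (hfin : ∀ T, {τ | τ ∈ Ioo t T ∧ ¬ ContinuousAt A τ}.Finite) (hπ : IsTransition A t j π)
    (hr : ∀ l, ContinuousOn (fun τ => r τ l) (Ici t))
    (hi : IntegrableOn (fun τ => Real.exp (-ρ * (τ - t)) * ∑ l, π τ l * r τ l) (Ioi t))
    (U : Obj → ℝ) (hle : ∀ τ, t < τ → ∀ l, -(ρ * U l) + ∑ k, A τ l k * U k + r τ l ≤ η) :
    ∫ τ in Ioi t, Real.exp (-ρ * (τ - t)) * ∑ l, π τ l * r τ l ≤ U j + η / ρ := by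
  refine hπ.integral_le (U := fun _ l => U l + η / ρ) (U' := fun _ _ => 0)
    (B := ∑ l, |U l + η / ρ|) hρ hA hfin hr hi (fun _ => continuousOn_const)
    (fun τ _ l => hasDerivAt_const _ _) ?_ ?_
  · intro τ _ l
    exact Finset.single_le_sum (f := fun l => |U l + η / ρ|) (fun _ _ => abs_nonneg _)
      (Finset.mem_univ l)
  · intro τ hτ l
    have h := hle τ hτ l
    simp only [mul_add, Finset.sum_add_distrib, ← Finset.sum_mul, (hA τ hτ).row_sum]
    rw [mul_div_cancel₀ _ hρ.ne']
    linarith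

theorem IsTransition.abs_integral_sub_le (hρ : 0 < ρ) (hA : ∀ τ, t < τ → IsGenerator (A τ) C)
    (hfin : ∀ T, {τ | τ ∈ Ioo t T ∧ ¬ ContinuousAt A τ}.Finite) (hπ : IsTransition A t j π)
    (hr : ∀ l, ContinuousOn (fun τ => r τ l) (Ici t))
    (hi : IntegrableOn (fun τ => Real.exp (-ρ * (τ - t)) * ∑ l, π τ l * r τ l) (Ioi t))
    (U : Obj → ℝ) (hle : ∀ τ, t < τ → ∀ l, |-(ρ * U l) + ∑ k, A τ l k * U k + r τ l| ≤ η) :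
    |(∫ τ in Ioi t, Real.exp (-ρ * (τ - t)) * ∑ l, π τ l * r τ l) - U j| ≤ η / ρ := by
  have h1 := hπ.integral_le_const hρ hA hfin hr hi U fun τ hτ l => (abs_le.1 (hle τ hτ l)).2
  have heq : (fun τ => Real.exp (-ρ * (τ - t)) * ∑ l, π τ l * -r τ l) =
      fun τ => -(Real.exp (-ρ * (τ - t)) * ∑ l, π τ l * r τ l) := by
    funext τ
    simp only [mul_neg, Finset.sum_neg_distrib]
  have h2 := hπ.integral_le_const (r := fun τ l => -r τ l) (η := η) hρ hA hfin
    (fun l => (hr l).neg) (by rw [heq]; exact hi.neg) (fun l => -U l) fun τ hτ l => by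
      have := (abs_le.1 (hle τ hτ l)).1
      simp only [mul_neg, Finset.sum_neg_distrib]
      linarith
  rw [heq, integral_neg] at h2
  rw [abs_le]
  constructor <;> linarith

end Transition

/-- Minimum principle: `ρ - A` has a nonnegative inverse. -/
theorem IsGenerator.nonneg_of_resolvent_nonneg {A : Obj → Obj → ℝ} {C ρ : ℝ}
    (hA : IsGenerator A C) (hρ : 0 < ρ) {v b : Obj → ℝ} (hb : ∀ l, 0 ≤ b l)
    (hv : ∀ l, ρ * v l - ∑ k, A l k * v k = b l) (l : Obj) : 0 ≤ v l := by
  obtain ⟨m, -, hm⟩ := Finset.exists_min_image Finset.univ v ⟨none, Finset.mem_univ _⟩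
  have h1 : ∑ k, A m k * v k = ∑ k, A m k * (v k - v m) := by
    simp only [mul_sub, Finset.sum_sub_distrib, ← Finset.sum_mul, hA.row_sum]
    ring
  have h2 : 0 ≤ ∑ k, A m k * (v k - v m) := by
    refine Finset.sum_nonneg fun k _ => ?_
    by_cases h : m = k
    · simp [h]
    · exact mul_nonneg (hA.nonneg m k h) (sub_nonneg.2 (hm k (Finset.mem_univ k)))
  have h3 : 0 ≤ ρ * v m := by
    have := hv m
    have := hb m
    linarith
  exact (nonneg_of_mul_nonneg_right h3 hρ).trans (hm l (Finset.mem_univ l))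

/-- The stationary Bellman equation is solvable, since `ρ - A` is injective by the minimum
principle. -/
theorem IsGenerator.exists_resolvent {A : Obj → Obj → ℝ} {C ρ : ℝ} (hA : IsGenerator A C)
    (hρ : 0 < ρ) (r : Obj → ℝ) : ∃ U : Obj → ℝ, ∀ l, -(ρ * U l) + ∑ k, A l k * U k + r l = 0 := by
  let f : (Obj → ℝ) →ₗ[ℝ] (Obj → ℝ) := ρ • LinearMap.id - Matrix.mulVecLin (Matrix.of A)
  have hf : ∀ v l, f v l = ρ * v l - ∑ k, A l k * v k := fun v l => by
    simp [f, Matrix.mulVec, dotProduct, -Fintype.sum_option]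
  have hinj : Function.Injective f := by
    rw [injective_iff_map_eq_zero]
    intro v hv
    have h0 : ∀ l, ρ * v l - ∑ k, A l k * v k = 0 := fun l => by rw [← hf, hv]; rfl
    funext l
    refine le_antisymm ?_ (hA.nonneg_of_resolvent_nonneg hρ (b := 0) (fun _ => le_rfl) h0 l)
    have := hA.nonneg_of_resolvent_nonneg hρ (v := -v) (b := 0) (fun _ => le_rfl) (fun l => by
      have := h0 l
      simp only [Pi.neg_apply, mul_neg, Finset.sum_neg_distrib, Pi.zero_apply]
      linarith) l
    simpa using this
  obtain ⟨U, hU⟩ := LinearMap.injective_iff_surjective.1 hinj r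
  refine ⟨U, fun l => ?_⟩
  rw [← hU, hf]
  ring

/-! ### Pure choices, transition rates and flows of utility -/

variable {E : Economy}

theorem accept_eq_zero_or_one {x : Choice} (hx : x ∈ pureChoices) (i : Fin 3) (j k : Obj) :
    accept i x j k = 0 ∨ accept i x j k = 1 := by
  simp only [pureChoices, mem_insert_iff, mem_singleton_iff] at hx
  unfold accept
  rcases hx with rfl | rfl | rfl | rfl | rfl | rfl <;> split_ifs <;> simp

theorem accept_nonneg {x : Choice} (hx : x ∈ pureChoices) (i : Fin 3) (j k : Obj) :
    0 ≤ accept i x j k := by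
  rcases accept_eq_zero_or_one hx i j k with h | h <;> simp [h]

theorem accept_le_one {x : Choice} (hx : x ∈ pureChoices) (i : Fin 3) (j k : Obj) :
    accept i x j k ≤ 1 := by
  rcases accept_eq_zero_or_one hx i j k with h | h <;> simp [h]

theorem add_one_ne_self (i : Fin 3) : i + 1 ≠ i := by decide +revert

theorem add_two_ne_self (i : Fin 3) : i + 2 ≠ i := by decide +revert

theorem add_one_ne_add_two (i : Fin 3) : i + 1 ≠ i + 2 := by decide +revert

theorem eq_of_ne_some (i : Fin 3) {j : Obj} (hj : j ≠ some i) :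
    j = none ∨ j = some (i + 1) ∨ j = some (i + 2) := by
  revert hj; revert i j; decide

theorem accept_swap (i : Fin 3) (x : Choice) {j k : Obj} (hj : j ≠ some i) (hk : k ≠ some i)
    (hjk : j ≠ k) : accept i x k j = 1 - accept i x j k := by
  have h1 : i + 1 ≠ i := add_one_ne_self i
  have h2 : i + 2 ≠ i := add_two_ne_self i
  have h3 : i + 1 ≠ i + 2 := add_one_ne_add_two i
  rcases eq_of_ne_some i hj with rfl | rfl | rfl <;> rcases eq_of_ne_some i hk with rfl | rfl | rfl
    <;> simp_all [accept, h3.symm]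

theorem continuous_accept (i : Fin 3) (j k : Obj) :
    Continuous fun x : Choice => accept i x j k := by
  unfold accept
  split_ifs <;> fun_prop

theorem Economy.θ_le_one (E : Economy) (i : Fin 3) : E.θ i ≤ 1 := by
  rw [← E.θ_sum]
  exact Finset.single_le_sum (f := E.θ) (fun i _ => (E.θ_pos i).le) (Finset.mem_univ i)

theorem Economy.δg_nonneg (E : Economy) : 0 ≤ E.δg :=
  div_nonneg (mul_nonneg E.δm_nonneg E.M_nonneg) (sub_nonneg.2 E.M_lt_one.le)

theorem le_one_of_mem_feasible {p : Dist} (hp : p ∈ E.feasible) (i : Fin 3) (j : Obj) :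
    p i j ≤ 1 := by
  refine le_trans ?_ (E.θ_le_one i)
  rw [← hp.2.2.1 i]
  exact Finset.single_le_sum (f := p i) (fun j _ => hp.1 i j) (Finset.mem_univ j)

theorem partners_nonneg {p : Dist} {s : Profile} (hp : p ∈ E.feasible) (hs : ∀ i, s i ∈ pureChoices)
    (j k : Obj) : 0 ≤ partners p s j k :=
  Finset.sum_nonneg fun i _ => mul_nonneg (hp.1 i k) (accept_nonneg (hs i) i k j)

theorem partners_le {p : Dist} {s : Profile} (hp : p ∈ E.feasible) (hs : ∀ i, s i ∈ pureChoices)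
    (j k : Obj) : partners p s j k ≤ 3 := by
  calc partners p s j k ≤ ∑ _i : Fin 3, (1 : ℝ) := Finset.sum_le_sum fun i _ =>
        mul_le_one₀ (le_one_of_mem_feasible hp i k) (accept_nonneg (hs i) i k j)
          (accept_le_one (hs i) i k j)
    _ = 3 := by simp

theorem continuous_partners (s : Profile) (j k : Obj) :
    Continuous fun p : Dist => partners p s j k := by
  unfold partners
  fun_prop

theorem continuous_gen (E : Economy) (i : Fin 3) (s : Profile) (j k : Obj) :
    Continuous fun q : Choice × Dist => E.gen i q.1 s q.2 j k := by
  have hrate : ∀ j k, Continuous fun q : Choice × Dist => E.rate i q.1 s q.2 j k := by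
    intro j k
    have h1 := (continuous_accept i j k).comp (continuous_fst (X := Choice) (Y := Dist))
    have h2 := fun j k => (continuous_partners s j k).comp (continuous_snd (X := Choice) (Y := Dist))
    simp only [Function.comp_def] at h1 h2
    unfold Economy.rate
    have h3 := h2 j k
    have h4 := h2 j (some i)
    split_ifs <;> fun_prop
  unfold Economy.gen
  split_ifs
  · exact (continuous_finsetSum _ fun l _ => hrate j l).neg
  · exact hrate j k

theorem continuous_flow (E : Economy) (i : Fin 3) (s : Profile) (l : Obj) :
    Continuous fun p : Dist => E.flow i s p l := by
  have := continuous_partners s l (some i)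
  unfold Economy.flow
  fun_prop

/-- A bound on all the transition rates of an individual. -/
noncomputable def Economy.rateBound (E : Economy) : ℝ := 6 * E.α + E.δm + E.δg

theorem rate_nonneg {p : Dist} {s : Profile} {x : Choice} (hp : p ∈ E.feasible)
    (hs : ∀ i, s i ∈ pureChoices) (hx : x ∈ pureChoices) (i : Fin 3) (j k : Obj) :
    0 ≤ E.rate i x s p j k := by
  have h1 := accept_nonneg hx i j k
  have h2 := partners_nonneg hp hs j k
  have h3 := partners_nonneg hp hs j (some i)
  have h4 := E.α_pos
  have h5 := E.δg_nonneg
  have h6 := E.δm_nonneg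
  unfold Economy.rate
  split_ifs <;> positivity

theorem rate_le {p : Dist} {s : Profile} {x : Choice} (hp : p ∈ E.feasible)
    (hs : ∀ i, s i ∈ pureChoices) (hx : x ∈ pureChoices) (i : Fin 3) (j k : Obj) :
    E.rate i x s p j k ≤ E.rateBound := by
  have h4 := E.α_pos
  have h5 := E.δg_nonneg
  have h6 := E.δm_nonneg
  have h1 : E.α * accept i x j k * partners p s j k ≤ 3 * E.α := by
    have := mul_le_mul (accept_le_one hx i j k) (partners_le hp hs j k) (partners_nonneg hp hs j k)
      zero_le_one
    nlinarith
  have h3 : E.α * partners p s j (some i) ≤ 3 * E.α := by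
    have := partners_le hp hs j (some i)
    nlinarith
  unfold Economy.rate Economy.rateBound
  split_ifs <;> linarith

theorem isGenerator_gen {p : Dist} {s : Profile} {x : Choice} (hp : p ∈ E.feasible)
    (hs : ∀ i, s i ∈ pureChoices) (hx : x ∈ pureChoices) (i : Fin 3) :
    IsGenerator (E.gen i x s p) (4 * E.rateBound) := by
  have h0 := fun j k => rate_nonneg hp hs hx i j k
  have h1 := fun j k => rate_le hp hs hx i j k
  have hR : 0 ≤ E.rateBound := (h0 none none).trans (h1 none none)
  refine ⟨fun j k hjk => ?_, fun j => ?_, fun j k => ?_⟩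
  · simpa [Economy.gen, hjk] using h0 j k
  · rw [← Finset.add_sum_erase _ _ (Finset.mem_univ j)]
    have : ∑ k ∈ Finset.univ.erase j, E.gen i x s p j k =
        ∑ k ∈ Finset.univ.erase j, E.rate i x s p j k :=
      Finset.sum_congr rfl fun k hk => by
        simp [Economy.gen, (Finset.ne_of_mem_erase hk).symm]
    rw [this]
    simp only [Economy.gen, if_true]
    ring
  · unfold Economy.gen
    split_ifs
    · rw [abs_neg, abs_of_nonneg (Finset.sum_nonneg fun l _ => h0 j l)]
      calc _ ≤ ∑ l, E.rate i x s p j l := Finset.sum_le_sum_of_subset_of_nonneg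
            (Finset.erase_subset _ _) fun l _ _ => h0 j l
        _ ≤ ∑ _l : Obj, E.rateBound := Finset.sum_le_sum fun l _ => h1 j l
        _ = _ := by simp [-Fintype.sum_option]
    · rw [abs_of_nonneg (h0 j k)]
      linarith [h1 j k]

/-- A bound on the utility flow of an individual of type `i`. -/
noncomputable def Economy.flowBound (E : Economy) (i : Fin 3) : ℝ :=
  3 * E.α * |E.u i| + ∑ l : Obj, |l.elim (E.δm * E.D i) E.c|

theorem abs_flow_le {p : Dist} {s : Profile} (hp : p ∈ E.feasible)
    (hs : ∀ i, s i ∈ pureChoices) (i : Fin 3) (l : Obj) : |E.flow i s p l| ≤ E.flowBound i := by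
  unfold Economy.flow Economy.flowBound
  refine (abs_sub _ _).trans (add_le_add ?_ (Finset.single_le_sum
    (f := fun l : Obj => |l.elim (E.δm * E.D i) E.c|) (fun _ _ => abs_nonneg _)
    (Finset.mem_univ l)))
  rw [abs_mul, abs_mul, abs_of_pos E.α_pos, abs_of_nonneg (partners_nonneg hp hs _ _)]
  have h1 := partners_le hp hs l (some i)
  have h2 := mul_nonneg E.α_pos.le (abs_nonneg (E.u i))
  nlinarith

/-- The choice `x` of an individual of type `i` gives up an object exactly for those objects that
have a higher value under `V`; ties are left free. -/
def Ranks (i : Fin 3) (x : Choice) (V : Obj → ℝ) : Prop :=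
  ∀ j k, j ≠ some i → k ≠ some i → j ≠ k →
    (V j < V k → accept i x j k = 1) ∧ (V k < V j → accept i x j k = 0)

/-- Values without ties are ranked by a pure choice, `pureChoices` being the transitive ones. -/
theorem exists_ranks (i : Fin 3) {V : Obj → ℝ}
    (hV : ∀ j k, j ≠ some i → k ≠ some i → j ≠ k → V j ≠ V k) :
    ∃ x ∈ pureChoices, Ranks i x V := by
  have h1 : i + 1 ≠ i := add_one_ne_self i
  have h2 : i + 2 ≠ i := add_two_ne_self i
  have h3 : i + 1 ≠ i + 2 := add_one_ne_add_two i
  have e1 : V (some (i + 1)) ≠ V none := hV _ _ (by simp) (by simp) (by simp)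
  have e2 : V (some (i + 2)) ≠ V none := hV _ _ (by simp) (by simp) (by simp)
  have e3 : V (some (i + 1)) ≠ V (some (i + 2)) :=
    hV _ _ (by simp) (by simp) (by simp)
  refine ⟨(if V (some (i + 1)) < V none then 1 else 0, if V (some (i + 2)) < V none then 1 else 0,
    if V (some (i + 1)) < V (some (i + 2)) then 1 else 0), ?_, fun j k hj hk hjk => ?_⟩
  · simp only [pureChoices, mem_insert_iff, mem_singleton_iff]
    split_ifs <;> simp
    all_goals
      exfalso
      rcases lt_or_gt_of_ne e1 with _ | _ <;> rcases lt_or_gt_of_ne e2 with _ | _ <;>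
        rcases lt_or_gt_of_ne e3 with _ | _ <;> linarith
  · rcases eq_of_ne_some i hj with rfl | rfl | rfl <;>
      rcases eq_of_ne_some i hk with rfl | rfl | rfl <;>
      first
      | exact absurd rfl hjk
      | constructor <;> intro h <;> simp [accept, h1, h2, h3, h3.symm, h, not_lt.2 h.le]

/-- Switching from `x` to `y` changes the generator applied to `V` by the gains on the trades the
individual herself decides about. -/
theorem gen_sum_sub (E : Economy) (i : Fin 3) (x y : Choice) (s : Profile) (p : Dist)
    (V : Obj → ℝ) (j : Obj) :
    ∑ k, E.gen i y s p j k * V k - ∑ k, E.gen i x s p j k * V k =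
      ∑ k, if j = some i ∨ k = some i ∨ j = k then 0 else
        E.α * (accept i y j k - accept i x j k) * partners p s j k * (V k - V j) := by
  have key : ∀ z, ∑ k, E.gen i z s p j k * V k =
      ∑ k ∈ Finset.univ.erase j, E.rate i z s p j k * (V k - V j) := by
    intro z
    rw [← Finset.add_sum_erase _ _ (Finset.mem_univ j)]
    have : ∑ k ∈ Finset.univ.erase j, E.gen i z s p j k * V k =
        ∑ k ∈ Finset.univ.erase j, E.rate i z s p j k * V k :=
      Finset.sum_congr rfl fun k hk => by
        simp [Economy.gen, (Finset.ne_of_mem_erase hk).symm]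
    rw [this]
    simp only [Economy.gen, if_true, mul_sub, Finset.sum_sub_distrib, ← Finset.sum_mul]
    ring
  rw [key, key, ← Finset.sum_sub_distrib, ← Finset.add_sum_erase _ _ (Finset.mem_univ j)]
  simp only [or_true, if_true, zero_add]
  refine Finset.sum_congr rfl fun k hk => ?_
  have hk' := (Finset.ne_of_mem_erase hk).symm
  by_cases h : j = some i ∨ k = some i
  · have h' : j = some i ∨ k = some i ∨ j = k := by tauto
    simp only [Economy.rate, if_pos h, if_pos h', sub_self, zero_mul]
  · have h' : ¬ (j = some i ∨ k = some i ∨ j = k) := by tauto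
    simp only [Economy.rate, if_neg h, if_neg h']
    ring

/-- Every term in `gen_sum_sub` is nonnegative when the new choice ranks the objects by `V`. -/
theorem improvement_nonneg {i : Fin 3} {x y : Choice} {s : Profile} {p : Dist} {V : Obj → ℝ}
    (hp : p ∈ E.feasible) (hs : ∀ i, s i ∈ pureChoices) (hx : x ∈ pureChoices)
    (hy : Ranks i y V) (j k : Obj) :
    0 ≤ if j = some i ∨ k = some i ∨ j = k then 0 else
        E.α * (accept i y j k - accept i x j k) * partners p s j k * (V k - V j) := by
  split_ifs with h
  · exact le_rfl
  · push Not at h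
    have hP := mul_nonneg E.α_pos.le (partners_nonneg hp hs j k)
    rcases lt_trichotomy (V j) (V k) with hV | hV | hV
    · rw [((hy j k h.1 h.2.1 h.2.2).1 hV)]
      have := mul_nonneg (mul_nonneg hP (sub_nonneg.2 (accept_le_one hx i j k)))
        (sub_nonneg.2 hV.le)
      linarith
    · simp [hV]
    · rw [((hy j k h.1 h.2.1 h.2.2).2 hV)]
      have := mul_nonneg (mul_nonneg hP (accept_nonneg hx i j k)) (sub_nonneg.2 hV.le)
      linarith

theorem gen_sum_le_of_ranks {i : Fin 3} {x y : Choice} {s : Profile} {p : Dist} {V : Obj → ℝ}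
    (hp : p ∈ E.feasible) (hs : ∀ i, s i ∈ pureChoices) (hx : x ∈ pureChoices)
    (hy : Ranks i y V) (j : Obj) :
    ∑ k, E.gen i x s p j k * V k ≤ ∑ k, E.gen i y s p j k * V k := by
  rw [← sub_nonneg, gen_sum_sub]
  exact Finset.sum_nonneg fun k _ => improvement_nonneg hp hs hx hy j k

/-! ### Best responses along a path of distributions -/

theorem piecewiseCont_const {X : Type*} [TopologicalSpace X] (x : X) :
    PiecewiseCont fun _ : ℝ => x := by
  intro T
  convert Set.finite_empty
  ext t
  simp [continuousWithinAt_const]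

theorem admissibleChoice_const {x : Choice} (hx : x ∈ pureChoices) :
    AdmissibleChoice fun _ => x :=
  ⟨fun _ _ => hx, piecewiseCont_const x⟩

theorem finite_not_continuousAt_gen (s : Profile) {p : ℝ → Dist} {y : ℝ → Choice}
    (hp : ContinuousOn p (Ici 0)) (hy : PiecewiseCont y) (i : Fin 3) {t : ℝ} (ht : 0 ≤ t) (T : ℝ) :
    {τ | τ ∈ Ioo t T ∧ ¬ ContinuousAt (fun τ => E.gen i (y τ) s (p τ)) τ}.Finite := by
  refine (hy T).subset fun τ hτ => ?_
  obtain ⟨hτ, hn⟩ := hτ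
  have h0 : 0 < τ := ht.trans_lt hτ.1
  refine ⟨⟨h0.le, hτ.2.le⟩, fun hc => hn ?_⟩
  have hyc : ContinuousAt y τ := hc.continuousAt (Ici_mem_nhds h0)
  have hpc : ContinuousAt p τ := hp.continuousAt (Ici_mem_nhds h0)
  refine continuousAt_pi.2 fun j => continuousAt_pi.2 fun k => ?_
  exact ContinuousAt.comp (f := fun τ => (y τ, p τ)) (continuous_gen E i s j k).continuousAt
    (hyc.prodMk hpc)

/-- The value of a constant choice along a path of distributions, as a differentiable function of
the initial time. -/
theorem exists_isValue {s : Profile} {p : ℝ → Dist} {x : Choice} (hp : ContinuousOn p (Ici 0))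
    (hpΩ : ∀ t, 0 ≤ t → p t ∈ E.feasible) (hs : ∀ i, s i ∈ pureChoices) (hx : x ∈ pureChoices)
    (i : Fin 3) :
    ∃ W : ℝ → Obj → ℝ,
      (∀ t, 0 ≤ t → ∀ j, E.IsValue p (fun _ => s) i (fun _ => x) t j (W t j)) ∧
      (∀ t, 0 ≤ t → ∀ j, |W t j| ≤ E.flowBound i / E.ρ) ∧
      ∀ t, 0 ≤ t → ∀ j, HasDerivAt (fun t => W t j)
        (E.ρ * W t j - E.flow i s (p t) j - ∑ k, E.gen i x s (p t) j k * W t k) t := by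
  -- Freezing the path before time zero makes the generator continuous on the whole line.
  obtain ⟨q, hqp, hqc, hqΩ⟩ : ∃ q : ℝ → Dist, (∀ t, 0 ≤ t → q t = p t) ∧ Continuous q ∧
      ∀ t, q t ∈ E.feasible :=
    ⟨fun t => p (max t 0), fun t ht => by simp [ht],
      hp.comp_continuous (by fun_prop) fun t => mem_Ici.2 (le_max_right _ _),
      fun t => hpΩ _ (le_max_right _ _)⟩
  have hAc : ∀ j k, Continuous fun t => E.gen i x s (q t) j k := fun j k =>
    Continuous.comp (g := fun z : Choice × Dist => E.gen i z.1 s z.2 j k) (f := fun t => (x, q t))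
      (continuous_gen E i s j k) (continuous_const.prodMk hqc)
  have hrc : ∀ l, Continuous fun t => E.flow i s (q t) l := fun l =>
    (continuous_flow E i s l).comp hqc
  obtain ⟨π, W, hπ, hB, hW⟩ := exists_transition_and_value (A := fun t => E.gen i x s (q t))
    (r := fun t => E.flow i s (q t)) E.ρ_pos hAc (fun t => isGenerator_gen (hqΩ t) hs hx i) hrc
    (fun t l => abs_flow_le (hqΩ t) hs i l)
  have hAt : Continuous fun t => E.gen i x s (q t) :=
    continuous_pi fun j => continuous_pi fun k => hAc j k
  refine ⟨W, fun t ht j => ?_, hB, fun t ht j => ?_⟩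
  · obtain ⟨⟨h1, h2, h3⟩, h4, h5⟩ := hπ t ht j
    have heq : EqOn (fun τ => Real.exp (-E.ρ * (τ - t)) * ∑ l, π t j τ l * E.flow i s (q τ) l)
        (fun τ => Real.exp (-E.ρ * (τ - t)) * ∑ l, π t j τ l * E.flow i s (p τ) l) (Ioi t) := by
      intro τ hτ
      dsimp only
      rw [hqp τ (ht.trans (le_of_lt hτ))]
    refine ⟨π t j, ⟨h1, h2, fun τ hτ _ => ?_⟩, h4.congr_fun heq measurableSet_Ioi,
      h5.trans (setIntegral_congr_fun measurableSet_Ioi heq)⟩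
    have h6 := h3 τ hτ hAt.continuousAt
    dsimp only at h6
    rw [hqp τ (ht.trans hτ.le)] at h6
    exact h6
  · have h6 := hW t ht j
    rw [hqp t ht] at h6
    exact h6

/-- A constant `U` that solves the Bellman equation along the path up to an error `η` is within
`η / ρ` of the value. -/
theorem IsValue.abs_sub_le {s : Profile} {p : ℝ → Dist} {x : ℝ → Choice}
    (hp : ContinuousOn p (Ici 0)) (hpΩ : ∀ t, 0 ≤ t → p t ∈ E.feasible)
    (hs : ∀ i, s i ∈ pureChoices) (hx : AdmissibleChoice x) {i : Fin 3} {t : ℝ} (ht : 0 ≤ t)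
    {j : Obj} {w : ℝ} (hw : E.IsValue p (fun _ => s) i x t j w) (U : Obj → ℝ) {η : ℝ}
    (hU : ∀ τ, t < τ → ∀ l, |-(E.ρ * U l) + ∑ k, E.gen i (x τ) s (p τ) l k * U k +
      E.flow i s (p τ) l| ≤ η) : |w - U j| ≤ η / E.ρ := by
  obtain ⟨π, hπ, hi, rfl⟩ := hw
  have hpt : ContinuousOn p (Ici t) := hp.mono (Ici_subset_Ici.2 ht)
  exact hπ.abs_integral_sub_le (r := fun τ => E.flow i s (p τ)) E.ρ_pos
    (fun τ hτ => isGenerator_gen (hpΩ τ (ht.trans hτ.le)) hs (hx.1 τ (ht.trans hτ.le)) i)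
    (finite_not_continuousAt_gen s hp hx.2 i ht)
    (fun l => (continuous_flow E i s l).comp_continuousOn hpt) hi U hU

/-- Verification: if `x` ranks the objects by its own value `W` at all times, no admissible
deviation does better. -/
theorem IsValue.le_of_ranks {s : Profile} {p : ℝ → Dist} {x : Choice} {y : ℝ → Choice}
    (hp : ContinuousOn p (Ici 0)) (hpΩ : ∀ t, 0 ≤ t → p t ∈ E.feasible)
    (hs : ∀ i, s i ∈ pureChoices) {i : Fin 3} {W : ℝ → Obj → ℝ}
    (hB : ∀ t, 0 ≤ t → ∀ j, |W t j| ≤ E.flowBound i / E.ρ)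
    (hW : ∀ t, 0 ≤ t → ∀ j, HasDerivAt (fun t => W t j)
        (E.ρ * W t j - E.flow i s (p t) j - ∑ k, E.gen i x s (p t) j k * W t k) t)
    (hrank : ∀ t, 0 ≤ t → Ranks i x (W t)) (hy : AdmissibleChoice y) {t : ℝ} (ht : 0 ≤ t)
    {j : Obj} {w : ℝ} (hw : E.IsValue p (fun _ => s) i y t j w) : w ≤ W t j := by
  obtain ⟨π, hπ, hi, rfl⟩ := hw
  have hpt : ContinuousOn p (Ici t) := hp.mono (Ici_subset_Ici.2 ht)
  refine hπ.integral_le (r := fun τ => E.flow i s (p τ)) E.ρ_pos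
    (fun τ hτ => isGenerator_gen (hpΩ τ (ht.trans hτ.le)) hs (hy.1 τ (ht.trans hτ.le)) i)
    (finite_not_continuousAt_gen s hp hy.2 i ht)
    (fun l => (continuous_flow E i s l).comp_continuousOn hpt) hi
    (fun l τ hτ => (hW τ (ht.trans hτ) l).continuousAt.continuousWithinAt)
    (fun τ hτ l => hW τ (ht.trans hτ.le) l) (fun τ hτ => hB τ (ht.trans hτ)) fun τ hτ l => ?_
  have h0 := ht.trans hτ.le
  have := gen_sum_le_of_ranks (hpΩ τ h0) hs (hy.1 τ h0) (hrank τ h0) l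
  linarith

/-- At a Nash steady state the values are distinct, and the choice ranks the objects by value. -/
theorem exists_steady_value_ranks {p : Dist} {s : Profile} (hN : E.IsNashSteadyState p s)
    (i : Fin 3) :
    ∃ U : Obj → ℝ,
      (∀ l, -(E.ρ * U l) + ∑ k, E.gen i (s i) s p l k * U k + E.flow i s p l = 0) ∧
      (∀ j k, j ≠ some i → k ≠ some i → j ≠ k → U j ≠ U k) ∧ Ranks i (s i) U := by
  obtain ⟨⟨hs, -⟩, ⟨-, hΩ, -⟩, hBR⟩ := hN
  replace hs := hs 0 le_rfl
  replace hΩ := hΩ 0 le_rfl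
  have hpc : ContinuousOn (fun _ : ℝ => p) (Ici 0) := continuousOn_const
  have hpΩ : ∀ t : ℝ, 0 ≤ t → p ∈ E.feasible := fun _ _ => hΩ
  have hG := fun {x} (hx : x ∈ pureChoices) => isGenerator_gen hΩ hs hx i
  obtain ⟨hx, V, hV, S, hS, hconv⟩ := hBR i
  obtain ⟨U, hU⟩ := (hG (hs i)).exists_resolvent E.ρ_pos (E.flow i s p)
  have hVU : ∀ t, 0 ≤ t → ∀ j, j ≠ some i → V t j = U j := by
    intro t ht j hj
    have := IsValue.abs_sub_le hpc hpΩ hs hx ht (hV t ht j hj).1 U (η := 0)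
      fun τ _ l => by rw [hU l, abs_zero]
    rw [zero_div] at this
    exact sub_eq_zero.1 (abs_nonpos_iff.1 this)
  -- One time off the exceptional set suffices, as nothing depends on time.
  obtain ⟨t, ht, htS⟩ : ∃ t : ℝ, 0 ≤ t ∧ t ∉ S := by
    by_contra! h
    refine (Icc_infinite (zero_lt_one (α := ℝ))) ((hS 1).subset fun t ht => ⟨h t ht.1, ht⟩)
  have hne : ∀ j k, j ≠ some i → k ≠ some i → j ≠ k → U j ≠ U k := by
    intro j k hj hk hjk h
    have h1 := (hconv t ht htS j k hj hk hjk).1 (by rw [hVU t ht j hj, hVU t ht k hk, h])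
    rcases accept_eq_zero_or_one (hs i) i j k with h2 | h2 <;> rw [h2] at h1 <;> norm_num at h1
  obtain ⟨y, hy, hyU⟩ := exists_ranks i hne
  -- The deviation to `y` raises no value, so its gains over `s i` all vanish.
  obtain ⟨U', hU'⟩ := (hG hy).exists_resolvent E.ρ_pos (E.flow i s p)
  have hle : ∀ j, j ≠ some i → U' j ≤ U j := by
    intro j hj
    obtain ⟨W, hW, -⟩ := exists_isValue (i := i) hpc hpΩ hs hy
    have h1 := hW 0 le_rfl j
    have h2 := IsValue.abs_sub_le hpc hpΩ hs (admissibleChoice_const hy) le_rfl h1 U' (η := 0)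
      fun τ _ l => by rw [hU' l, abs_zero]
    rw [zero_div] at h2
    rw [← hVU 0 le_rfl j hj, ← sub_eq_zero.1 (abs_nonpos_iff.1 h2)]
    exact (hV 0 le_rfl j hj).2.1 ⟨fun _ => y, admissibleChoice_const hy, h1⟩
  have hgain := fun j k => improvement_nonneg (x := s i) hΩ hs (hs i) hyU j k
  have hsum := fun j => gen_sum_sub E i (s i) y s p U j
  have hD : ∀ l, 0 ≤ U' l - U l := by
    refine (hG hy).nonneg_of_resolvent_nonneg E.ρ_pos (b := fun j => ∑ k, E.gen i y s p j k * U k -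
      ∑ k, E.gen i (s i) s p j k * U k) (fun j => ?_) fun l => ?_
    · rw [hsum]
      exact Finset.sum_nonneg fun k _ => hgain j k
    · have h1 := hU l
      have h2 := hU' l
      simp only [mul_sub, Finset.sum_sub_distrib]
      linarith
  -- Good `i` is never held, and the generator leaves the corresponding state fixed.
  have hself : ∀ x : Choice, ∀ k, E.gen i x s p (some i) k = 0 := by
    intro x k
    simp [Economy.gen, Economy.rate, -Fintype.sum_option]
  have hUU : U' = U := by
    funext l
    by_cases hl : l = some i
    · subst hl
      have h1 := hU (some i)
      have h2 := hU' (some i)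
      simp only [hself, zero_mul, Finset.sum_const_zero] at h1 h2
      exact mul_left_cancel₀ E.ρ_pos.ne' (by linarith)
    · exact le_antisymm (hle l hl) (sub_nonneg.1 (hD l))
  have hzero : ∀ j k, j ≠ some i → k ≠ some i → j ≠ k →
      E.α * (accept i y j k - accept i (s i) j k) * partners p s j k * (U k - U j) = 0 := by
    intro j k hj hk hjk
    have h1 := hU j
    have h2 := hU' j
    rw [hUU] at h2
    have h3 := hsum j
    have h4 := (Finset.sum_eq_zero_iff_of_nonneg fun k _ => hgain j k).1
      (h3.symm.trans (by linarith)) k (Finset.mem_univ k)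
    rwa [if_neg (by tauto)] at h4
  have hone : ∀ j k, j ≠ some i → k ≠ some i → j ≠ k → U j < U k → accept i (s i) j k = 1 := by
    intro j k hj hk hjk hlt
    refine (accept_eq_zero_or_one (hs i) i j k).resolve_left fun h0 => ?_
    have hα := E.α_pos.ne'
    have hsub : U k - U j ≠ 0 := (sub_pos.2 hlt).ne'
    have hsub' : U j - U k ≠ 0 := (sub_neg.2 hlt).ne
    have h1 : partners p s j k = 0 := by
      have := hzero j k hj hk hjk
      rw [h0, (hyU j k hj hk hjk).1 hlt] at this
      simpa [hα, hsub] using this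
    have h2 : partners p s k j = 0 := by
      have := hzero k j hk hj hjk.symm
      rw [accept_swap i (s i) hj hk hjk, h0, (hyU k j hk hj hjk.symm).2 hlt] at this
      simpa [hα, hsub'] using this
    have h3 := ((hconv t ht htS j k hj hk hjk).2 h1 h2).1 (by rwa [hVU t ht j hj, hVU t ht k hk])
    rw [h0] at h3
    exact zero_ne_one h3
  refine ⟨U, hU, hne, fun j k hj hk hjk => ⟨hone j k hj hk hjk, fun hlt => ?_⟩⟩
  have := hone k j hk hj hjk.symm hlt
  rw [accept_swap i (s i) hk hj hjk.symm, this, sub_self]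

theorem isBestResponse_of_ranks {s : Profile} {p : ℝ → Dist} (hp : ContinuousOn p (Ici 0))
    (hpΩ : ∀ t, 0 ≤ t → p t ∈ E.feasible) (hs : ∀ i, s i ∈ pureChoices) {i : Fin 3}
    {W : ℝ → Obj → ℝ}
    (hval : ∀ t, 0 ≤ t → ∀ j, E.IsValue p (fun _ => s) i (fun _ => s i) t j (W t j))
    (hB : ∀ t, 0 ≤ t → ∀ j, |W t j| ≤ E.flowBound i / E.ρ)
    (hW : ∀ t, 0 ≤ t → ∀ j, HasDerivAt (fun t => W t j)
        (E.ρ * W t j - E.flow i s (p t) j - ∑ k, E.gen i (s i) s (p t) j k * W t k) t)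
    (hne : ∀ t, 0 ≤ t → ∀ j k, j ≠ some i → k ≠ some i → j ≠ k → W t j ≠ W t k)
    (hrank : ∀ t, 0 ≤ t → Ranks i (s i) (W t)) :
    E.IsBestResponse p (fun _ => s) i fun _ => s i := by
  refine ⟨admissibleChoice_const (hs i), W, fun t ht j _ => ⟨hval t ht j, ?_, ?_⟩, ∅, by simp,
    fun t ht _ j k hj hk hjk => ⟨fun h => absurd h (hne t ht j k hj hk hjk),
      fun _ _ => hrank t ht j k hj hk hjk⟩⟩
  · rintro w ⟨y, hy, hw⟩
    exact IsValue.le_of_ranks hp hpΩ hs hB hW hrank hy ht hw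
  · exact fun b hb => hb ⟨_, admissibleChoice_const (hs i), hval t ht j⟩

/-- Along any path that stays close to a Nash steady state, the steady-state choice remains a best
response. -/
theorem exists_radius_isBestResponse {q : Dist} {s : Profile} (hN : E.IsNashSteadyState q s)
    (i : Fin 3) :
    ∃ ε > 0, ∀ p : ℝ → Dist, ContinuousOn p (Ici 0) → (∀ t, 0 ≤ t → p t ∈ E.feasible) →
      (∀ t, 0 ≤ t → dist (p t) q < ε) → E.IsBestResponse p (fun _ => s) i fun _ => s i := by
  obtain ⟨U, hU, hne, hrank⟩ := exists_steady_value_ranks hN i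
  have hs : ∀ i, s i ∈ pureChoices := hN.1.1 0 le_rfl
  -- A positive number, at most half of every gap between the steady-state values.
  obtain ⟨γ, hγ, hgap⟩ : ∃ γ > 0, ∀ j k, j ≠ some i → k ≠ some i → j ≠ k → 2 * γ ≤ |U j - U k| := by
    have : ∀ j k, ∃ γ > 0, j ≠ some i → k ≠ some i → j ≠ k → 2 * γ ≤ |U j - U k| := by
      intro j k
      by_cases h : j ≠ some i ∧ k ≠ some i ∧ j ≠ k
      · have := abs_pos.2 (sub_ne_zero.2 (hne j k h.1 h.2.1 h.2.2))
        exact ⟨|U j - U k| / 2, by positivity, fun _ _ _ => by linarith⟩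
      · exact ⟨1, one_pos, fun h1 h2 h3 => absurd ⟨h1, h2, h3⟩ h⟩
    choose g hg hg' using this
    obtain ⟨m, -, hm⟩ := Finset.exists_min_image Finset.univ (fun x : Obj × Obj => g x.1 x.2)
      ⟨(none, none), Finset.mem_univ _⟩
    exact ⟨g m.1 m.2, hg _ _, fun j k hj hk hjk => by
      linarith [hg' j k hj hk hjk, hm (j, k) (Finset.mem_univ _)]⟩
  have hη : 0 < γ * E.ρ / 2 := by have := E.ρ_pos; positivity
  -- At `q` the Bellman residual of `U` is zero, so near `q` it is small.
  have hnear : ∀ᶠ p in 𝓝 q, ∀ l, |-(E.ρ * U l) + ∑ k, E.gen i (s i) s p l k * U k +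
      E.flow i s p l| ≤ γ * E.ρ / 2 := by
    refine eventually_all.2 fun l => ?_
    have hc : Continuous fun p : Dist =>
        |-(E.ρ * U l) + ∑ k, E.gen i (s i) s p l k * U k + E.flow i s p l| := by
      refine (Continuous.add (continuous_const.add (continuous_finsetSum _ fun k _ => ?_))
        (continuous_flow E i s l)).abs
      exact ((continuous_gen E i s l k).comp (continuous_const.prodMk continuous_id)).mul
        continuous_const
    refine (hc.tendsto q).eventually_le_const ?_
    rwa [hU l, abs_zero]
  obtain ⟨ε, hε, hball⟩ := Metric.eventually_nhds_iff.1 hnear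
  refine ⟨ε, hε, fun p hp hpΩ hclose => ?_⟩
  obtain ⟨W, hval, hB, hW⟩ := exists_isValue (i := i) hp hpΩ hs (hs i)
  have hWU : ∀ t, 0 ≤ t → ∀ j, |W t j - U j| ≤ γ / 2 := by
    intro t ht j
    have := IsValue.abs_sub_le hp hpΩ hs (admissibleChoice_const (hs i)) ht (hval t ht j) U
      fun τ hτ => hball (hclose τ (ht.trans hτ.le))
    rwa [div_right_comm, mul_div_cancel_right₀ _ E.ρ_pos.ne'] at this
  have hlt : ∀ t, 0 ≤ t → ∀ j k, j ≠ some i → k ≠ some i → j ≠ k → U j < U k → W t j < W t k := by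
    intro t ht j k hj hk hjk h
    have h1 := abs_le.1 (hWU t ht j)
    have h2 := abs_le.1 (hWU t ht k)
    have h3 := hgap j k hj hk hjk
    rw [abs_of_neg (sub_neg.2 h)] at h3
    linarith
  have horder : ∀ t, 0 ≤ t → ∀ j k, j ≠ some i → k ≠ some i → j ≠ k → W t j < W t k →
      U j < U k := by
    intro t ht j k hj hk hjk h
    refine (lt_or_gt_of_ne (hne j k hj hk hjk)).resolve_right fun h' => ?_
    exact lt_asymm h (hlt t ht k j hk hj hjk.symm h')
  refine isBestResponse_of_ranks hp hpΩ hs hval hB hW ?_ ?_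
  · intro t ht j k hj hk hjk
    rcases lt_or_gt_of_ne (hne j k hj hk hjk) with h | h
    · exact (hlt t ht j k hj hk hjk h).ne
    · exact (hlt t ht k j hk hj hjk.symm h).ne'
  · exact fun t ht j k hj hk hjk => ⟨fun h => (hrank j k hj hk hjk).1 (horder t ht j k hj hk hjk h),
      fun h => (hrank j k hj hk hjk).2 (horder t ht k j hk hj hjk.symm h)⟩

/-! ### Trajectories of the inventory dynamics -/

/-- A function that starts nonnegative and cannot decrease while negative stays nonnegative. -/
theorem nonneg_of_hasDerivAt {f f' : ℝ → ℝ} (hf : ∀ t, HasDerivAt f (f' t) t) (h0 : 0 ≤ f 0)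
    (hneg : ∀ t, f t < 0 → 0 ≤ f' t) {t : ℝ} (ht : 0 ≤ t) : 0 ≤ f t := by
  have hd : ∀ s, HasDerivAt (fun s => min (f s) 0 ^ 2) (2 * min (f s) 0 * f' s) s := fun s =>
    (hasDerivAt_min_zero_sq (f s)).comp s (hf s)
  have h := le_of_hasDerivAt_nonpos_off_finite Set.finite_empty ht
    (fun s _ => (hd s).continuousAt.continuousWithinAt) (fun s _ _ => hd s) fun s _ _ => by
      rcases lt_or_ge (f s) 0 with h | h
      · rw [min_eq_left h.le]
        nlinarith [hneg s h]
      · simp [min_eq_right h]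
  simp only [min_eq_right h0] at h
  have h2 : min (f t) 0 = 0 := by
    have := le_antisymm (h.trans_eq (by simp)) (sq_nonneg _)
    exact pow_eq_zero_iff two_ne_zero |>.1 this
  exact min_eq_right_iff.1 h2

theorem sum_obj (i : Fin 3) (f : Obj → ℝ) :
    ∑ j, f j = f none + f (some i) + f (some (i + 1)) + f (some (i + 2)) := by
  rw [Fintype.sum_option, Fin.sum_univ_three]
  fin_cases i <;> simp <;> ring

theorem contDiff_field (E : Economy) (s : Profile) : ContDiff ℝ 1 (E.field s) := by
  refine contDiff_pi.2 fun i => contDiff_pi.2 fun j => ?_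
  have h : ∀ i j, ContDiff ℝ 1 fun p : Dist => p i j := fun i j => contDiff_apply_apply ℝ ℝ i j
  unfold Economy.field
  split_ifs <;> fun_prop

/-- Quasi-positivity: the inventory dynamics does not decrease a share that is zero. -/
theorem field_nonneg {s : Profile} {q : Dist} (hs : ∀ i, s i ∈ pureChoices)
    (hq : ∀ i j, 0 ≤ q i j) {i : Fin 3} {j : Obj} (h0 : q i j = 0) : 0 ≤ E.field s q i j := by
  have hg := E.δg_nonneg
  have hm := E.δm_nonneg
  have hα := E.α_pos.le
  have h1 : ∀ j, 0 ≤ ∑ k, q i k * accept i (s i) k j *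
      ∑ i', q i' j * accept i' (s i') j k := fun j =>
    Finset.sum_nonneg fun k _ => mul_nonneg (mul_nonneg (hq i k) (accept_nonneg (hs i) i k j))
      (Finset.sum_nonneg fun i' _ => mul_nonneg (hq i' j) (accept_nonneg (hs i') i' j k))
  have h2 : 0 ≤ ∑ k, q i k * ∑ i', q i' (some i) * accept i' (s i') (some i) k :=
    Finset.sum_nonneg fun k _ => mul_nonneg (hq i k)
      (Finset.sum_nonneg fun i' _ => mul_nonneg (hq i' _) (accept_nonneg (hs i') i' _ k))
  by_cases hj : j = some i
  · simp [Economy.field, hj]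
  have h3 := mul_nonneg hα (h1 j)
  have h4 := mul_nonneg hα h2
  have h5 := mul_nonneg hm (hq i none)
  have h6 := mul_nonneg hg (add_nonneg (hq i (some (i + 1))) (hq i (some (i + 2))))
  simp only [Economy.field, if_neg hj, h0, zero_mul, Finset.sum_const_zero, mul_zero, sub_zero,
    mul_add]
  rcases eq_of_ne_some i hj with rfl | rfl | rfl
  · simp only [h0, reduceCtorEq, if_false, if_true, mul_zero, sub_zero, add_zero]
    linarith
  · simp only [reduceCtorEq, if_false, if_true]
    linarith
  · simp only [reduceCtorEq, if_false, Option.some.injEq, (add_one_ne_add_two i).symm, mul_zero,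
      add_zero]
    linarith

/-- The inventory dynamics preserves the population shares of the types. -/
theorem sum_field (E : Economy) (s : Profile) (q : Dist) (i : Fin 3) :
    ∑ j, E.field s q i j = 0 := by
  set X : Obj → Obj → ℝ := fun j k => ∑ i', q i' j * accept i' (s i') j k with hX
  have h1 := add_one_ne_self i
  have h2 := add_two_ne_self i
  have h3 := add_one_ne_add_two i
  have hgive : ∀ k, accept i (s i) (some i) k = 0 := fun k => by simp [accept]
  have htake : ∀ k, k ≠ some i → accept i (s i) k (some i) = 1 := fun k hk => by
    simp [accept, hk]
  have hself : X (some i) (some i) = 0 := by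
    refine Finset.sum_eq_zero fun i' _ => ?_
    by_cases h : i' = i
    · subst h; simp [hgive]
    · simp [accept, Ne.symm h]
  have hfield : ∀ j, E.field s q i j = if j = some i then 0 else
      E.α * (∑ k, q i k * accept i (s i) k j * X j k - ∑ k, q i j * accept i (s i) j k * X k j +
        if j = some (i + 1) then ∑ k, q i k * X (some i) k else 0)
      + (if j = none then E.δg * (q i (some (i + 1)) + q i (some (i + 2))) - E.δm * q i none
         else if j = some (i + 1) then E.δm * q i none - E.δg * q i j
         else - E.δg * q i j) := fun j => rfl
  simp only [hfield, sum_obj i]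
  simp only [reduceCtorEq, if_false, if_true, Option.some.injEq, h1, h2, h3.symm, hgive,
    htake _ (show (none : Obj) ≠ some i by simp), htake (some (i + 1)) (by simp),
    htake (some (i + 2)) (by simp), hself]
  ring

/-- Trade only reshuffles money; its total mass changes through the government alone. -/
theorem sum_field_money (E : Economy) (s : Profile) (q : Dist) :
    ∑ i, E.field s q i none =
      ∑ i, (E.δg * (q i (some (i + 1)) + q i (some (i + 2))) - E.δm * q i none) := by
  have hfield : ∀ i, E.field s q i none =
      E.α * (∑ k, q i k * accept i (s i) k none * (∑ i', q i' none * accept i' (s i') none k)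
        - ∑ k, q i none * accept i (s i) none k * (∑ i', q i' k * accept i' (s i') k none))
      + (E.δg * (q i (some (i + 1)) + q i (some (i + 2))) - E.δm * q i none) := fun i => by
    simp [Economy.field, -Fintype.sum_option]
  simp only [hfield, Finset.sum_add_distrib, ← Finset.mul_sum, Finset.sum_sub_distrib]
  have : ∑ i, ∑ k, q i k * accept i (s i) k none * (∑ i', q i' none * accept i' (s i') none k) =
      ∑ i, ∑ k, q i none * accept i (s i) none k * (∑ i', q i' k * accept i' (s i') k none) := by
    rw [Finset.sum_comm]
    nth_rewrite 2 [Finset.sum_comm]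
    simp only [← Finset.sum_mul]
    exact Finset.sum_congr rfl fun k _ => mul_comm _ _
  rw [this, sub_self, mul_zero, zero_add]

theorem eq_of_hasDerivAt_zero {f : ℝ → ℝ} (hf : ∀ t, HasDerivAt f 0 t) (t : ℝ) : f t = f 0 :=
  is_const_of_deriv_eq_zero (fun t => (hf t).differentiableAt) (fun t => (hf t).deriv) t 0

/-- Every feasible distribution is the start of a trajectory under constant pure strategies. -/
theorem exists_isTrajectory {s : Profile} (hs : ∀ i, s i ∈ pureChoices) {p₀ : Dist}
    (hp₀ : p₀ ∈ E.feasible) :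
    ∃ p : ℝ → Dist, p 0 = p₀ ∧ E.IsTrajectory (fun _ => s) p := by
  set c : Dist → Dist := fun p i => clip 0 1 (p i) with hc
  have hc01 : ∀ p i j, c p i j ∈ Icc (0 : ℝ) 1 := fun p i j =>
    ⟨le_max_left _ _, max_le zero_le_one (min_le_left _ _)⟩
  have hcL : LipschitzWith 1 c := by
    refine LipschitzWith.of_dist_le_mul fun p q => ?_
    rw [NNReal.coe_one, one_mul]
    refine (dist_pi_le_iff dist_nonneg).2 fun i => le_trans ?_ (dist_le_pi_dist p q i)
    simpa using (lipschitzWith_clip 0 1).dist_le_mul (p i) (q i)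
  set K : Set Dist := Icc 0 1 with hK
  have hKc : IsCompact K := isCompact_Icc
  have hcK : ∀ p, c p ∈ K := fun p => ⟨fun i j => (hc01 p i j).1, fun i j => (hc01 p i j).2⟩
  obtain ⟨L, hL⟩ := ((contDiff_field E s).locallyLipschitz.locallyLipschitzOn
    (s := K)).exists_lipschitzOnWith_of_compact hKc
  obtain ⟨C, hC⟩ := hKc.exists_bound_of_continuousOn (contDiff_field E s).continuous.continuousOn
  have hLip : LipschitzWith L fun p => E.field s (c p) := by
    have h := hL.comp (hcL.lipschitzOnWith (s := univ)) fun p _ => hcK p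
    rw [mul_one, lipschitzOnWith_univ] at h
    exact h
  obtain ⟨p, hp0, hp⟩ := exists_hasDerivAt_of_lipschitz (f := fun _ p => E.field s (c p))
    (fun _ => hLip) (fun _ => continuous_const)
    (fun _ => ⟨C.toNNReal, fun _ _ p => (hC _ (hcK p)).trans (Real.le_coe_toNNReal C)⟩) p₀
  have hpij : ∀ i j t, HasDerivAt (fun t => p t i j) (E.field s (c (p t)) i j) t :=
    fun i j t => hasDerivAt_pi.1 (hasDerivAt_pi.1 (hp t) i) j
  have hnn : ∀ t, 0 ≤ t → ∀ i j, 0 ≤ p t i j := by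
    intro t ht i j
    refine nonneg_of_hasDerivAt (hpij i j) (by rw [hp0]; exact hp₀.1 i j) (fun t hneg => ?_) ht
    refine field_nonneg hs (fun i j => (hc01 _ i j).1) ?_
    exact max_eq_left ((min_le_right _ _).trans hneg.le)
  have hsum : ∀ t i, ∑ j, p t i j = E.θ i := by
    intro t i
    have h := eq_of_hasDerivAt_zero (f := fun t => ∑ j, p t i j) (fun t => by
      have := HasDerivAt.fun_sum fun j (_ : j ∈ Finset.univ) => hpij i j t
      rwa [sum_field] at this) t
    rw [h, hp0, hp₀.2.2.1 i]
  have hown : ∀ t i, p t i (some i) = 0 := by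
    intro t i
    have h := eq_of_hasDerivAt_zero (f := fun t => p t i (some i)) (fun t => by
      simpa [Economy.field] using hpij i (some i) t) t
    rw [h, hp0, hp₀.2.1 i]
  have hcp : ∀ t, 0 ≤ t → c (p t) = p t := by
    intro t ht
    funext i j
    have h1 : p t i j ≤ 1 := by
      refine le_trans ?_ (E.θ_le_one i)
      rw [← hsum t i]
      exact Finset.single_le_sum (f := p t i) (fun j _ => hnn t ht i j) (Finset.mem_univ j)
    simp only [hc, clip]
    rw [min_eq_right h1, max_eq_right (hnn t ht i j)]
  have hd : ∀ t, 0 ≤ t → HasDerivAt p (E.field s (p t)) t := fun t ht => by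
    simpa only [hcp t ht] using hp t
  -- The mass of money relaxes linearly towards `M`.
  have hmoney : ∀ t, 0 ≤ t → ∑ i, p t i none = E.M := by
    have hm : ∀ t, 0 ≤ t → HasDerivAt (fun t => ∑ i, p t i none - E.M)
        (-(E.δg + E.δm) * (∑ i, p t i none - E.M)) t := by
      intro t ht
      have h1 := (HasDerivAt.fun_sum fun i (_ : i ∈ Finset.univ) => hpij i none t).sub_const E.M
      refine h1.congr_deriv ?_
      rw [hcp t ht, sum_field_money]
      have h2 : ∀ i, p t i (some (i + 1)) + p t i (some (i + 2)) = E.θ i - p t i none := by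
        intro i
        have h3 := hsum t i
        rw [sum_obj i, hown] at h3
        linarith
      have h4 : E.δg * (1 - E.M) = E.δm * E.M :=
        div_mul_cancel₀ _ (sub_pos.2 E.M_lt_one).ne'
      simp only [h2, Finset.sum_sub_distrib, ← Finset.mul_sum, E.θ_sum]
      linarith
    intro t ht
    have h := le_of_hasDerivAt_nonpos_off_finite (f := fun t => (∑ i, p t i none - E.M) ^ 2)
      (f' := fun t => 2 * (∑ i, p t i none - E.M) * (-(E.δg + E.δm) * (∑ i, p t i none - E.M)))
      Set.finite_empty ht
      (fun s hs => ((hm s hs.1).continuousAt.pow 2).continuousWithinAt)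
      (fun s hs _ => by simpa using (hm s hs.1.le).fun_pow 2) fun s _ _ => by
        nlinarith [mul_nonneg (add_nonneg E.δg_nonneg E.δm_nonneg)
          (sq_nonneg (∑ i, p s i none - E.M))]
    have h0 : ∑ i, p 0 i none - E.M = 0 := by rw [hp0, hp₀.2.2.2, sub_self]
    simp only [h0] at h
    have := le_antisymm (h.trans_eq (by simp)) (sq_nonneg _)
    exact sub_eq_zero.1 (pow_eq_zero_iff two_ne_zero |>.1 this)
  exact ⟨p, hp0, fun t ht => (hd t ht).continuousAt.continuousWithinAt,
    fun t ht => ⟨hnn t ht, hown t, hsum t, hmoney t ht⟩, fun t ht _ => hd t ht.le⟩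

theorem dist_le_euclDist (p q : Dist) : dist p q ≤ euclDist p q := by
  refine (dist_pi_le_iff (Real.sqrt_nonneg _)).2 fun i =>
    (dist_pi_le_iff (Real.sqrt_nonneg _)).2 fun j => Real.le_sqrt_of_sq_le ?_
  rw [Real.dist_eq, sq_abs]
  exact (Finset.single_le_sum (f := fun j => (p i j - q i j) ^ 2) (fun _ _ => sq_nonneg _)
    (Finset.mem_univ j)).trans (Finset.single_le_sum
      (f := fun i => ∑ j, (p i j - q i j) ^ 2)
      (fun _ _ => Finset.sum_nonneg fun _ _ => sq_nonneg _) (Finset.mem_univ i))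

end Search

theorem proposition4 (E : Search.Economy) (pStar : Search.Dist) (sStar : Search.Profile)
    (hNash : E.IsNashSteadyState pStar sStar)
    (hStable : E.IsAsymptoticallyStable sStar pStar) :
    ∃ ε > 0, ∀ p₀ ∈ E.feasible, Search.euclDist p₀ pStar ≤ ε →
      (∃ p : ℝ → Search.Dist, p 0 = p₀ ∧ E.IsTrajectory (fun _ => sStar) p) ∧
      ∀ p : ℝ → Search.Dist, p 0 = p₀ → E.IsTrajectory (fun _ => sStar) p →
        E.IsNash p (fun _ => sStar) := by
  choose r hr hbest using fun i => Search.exists_radius_isBestResponse hNash i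
  obtain ⟨m, -, hm⟩ := Finset.exists_min_image Finset.univ r ⟨0, Finset.mem_univ _⟩
  obtain ⟨δ, hδ, hLyap⟩ := hStable.2.2.1 (r m) (hr m)
  -- Half of `δ`, since Lyapunov stability asks for a strict inequality.
  refine ⟨δ / 2, half_pos hδ, fun p₀ hp₀ hclose =>
    ⟨Search.exists_isTrajectory (hNash.1.1 0 le_rfl) hp₀, fun p hp0 hp =>
      ⟨hNash.1, hp, fun i => hbest i p hp.1 hp.2.1 fun t ht => ?_⟩⟩⟩
  have h0 : Search.euclDist (p 0) pStar < δ := by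
    rw [hp0]
    exact hclose.trans_lt (half_lt_self hδ)
  exact (Search.dist_le_euclDist _ _).trans_lt
    ((hLyap p hp h0 t ht).trans_le (hm i (Finset.mem_univ i)))
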